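/- Setting. A POMDP has finite sets $Q$ of states, $A\neq\emptyset$ of actions, $O$ of observations, and probabilities $\mathbf T(o,q'\mid q,a)$ with $\sum_{o,q'}\mathbf T(o,q'\mid q,a)=1$; write $\mathbf T(o\mid q,a)=\sum_{q'}\mathbf T(o,q'\mid q,a)$. It is posterior-deterministic if for all $q,a,o$ there is at most one $q'$ with $\mathbf T(o,q'\mid q,a)>0$. A sub-belief is $b:Q\to[0,1]$ with $\|b\|_1=\sum_q b(q)\le 1$ (a belief if $\|b\|_1=1$), and $\mathrm{supp}(b)=\{q: b(q)>0\}$. A strategy maps each word of $(A\times O)^*$ to a probability distribution on $A$, and $\mathrm{Val}(b)$ is the supremum over strategies of the measure, under the measure on runs started from $b$, of the runs that visit a target state $\top$. Put $\mathbf T(o\mid b,a)=\sum_q \mathbf T(o\mid q,a)\,b(q)$, let $b_{a,o}(q)=\frac{\sum_{q'}b(q')\mathbf T(o,q\mid q',a)}{\sum_{q''}\sum_{q'}b(q')\mathbf T(o,q''\mid q',a)}$, and $\mathrm{Val}(b,a)=\sum_o \mathbf T(o\mid b,a)\,\mathrm{Val}(b_{a,o})$. Assume that $\top$ and a state $\bot$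 are absorbing and observable (whenever the state is reached a specific observation is received, which is received only when that state is reached), and that $\bot$ is the only state of value $0$. Support end components. For a non-empty $S\subseteq Q$ (a belief support) let $\delta(S,a,o)=\{q':\exists q\in S,\ \mathbf T(o,q'\mid q,a)>0\}$, and let $\delta^*(S,h)$ be its extension to words $h\in(A\times O)^*$. An SEC is a partial function $f$ from belief supports to non-empty sets of actions such that $\delta(S,a,o)\in\mathrm{dom} f$ whenever $S\in\mathrm{dom} f$, $a\in f(S)$ and $\delta(S,a,o)\ne\emptyset$, and such that any two supports in $\mathrm{dom} f$ are reachable from each other by using actions allowed by $f$. It is maximal if it is maximal for containment (of domains and of values). For $S\in\mathrm{dom} f$, states $q,q'\in S$ are $(f,S)$-indistinguishable, $q\equiv_{f,S}q'$, if $\mathbf T(o\mid \delta^*(q,h),a)=\mathbf T(o\mid\delta^*(q',h),a)$ for all possible observable histories $h$ from $S$ inside $f$, all $a\in f(\delta^*(S,h))$ and all $o$. The SEC $f$ is distinguishing if some $S\in\mathrm{dom} f$ contains two states that are not $(f,S)$-indistinguishable. For a sub-belief $b$ with support in $\mathrm{dom} f$, $\mathrm{Reach}_f(b)$ is the set of sub-beliefs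 reachable from $b$ by updates $c\mapsto\|b\|_1\cdot c_{a,o}$ with $a\in f(\mathrm{supp}(c))$ and $\mathbf T(o\mid c,a)>0$. Rank. Write $T\preceq S$ if $T=\delta^*(S,h)$ for some $h$, and $S\le T$ if $S\preceq T$ or $|S|<|T|$. The rank of a belief support $S$ is the height of its class in the partial order induced by $\le$ (minimal classes have height $0$), and $\mathrm{rank}(b)=\|b\|_1\cdot\mathrm{rank}(\mathrm{supp}(b))$ (which is $0$ if $b=0$). Tree. Fix a cut threshold $\eta>0$. Nodes are labelled by a sub-belief $b$ or by a pair $(b,a)$; in both cases $\mathrm{belief}(x)=b$. A node is unfolded by the first applicable rule: (1) label $(b,a)$: sum node, with one child labelled $b_{a,o}$ and edge weight $\mathbf T(o\mid b,a)$ for each $o$ with $\mathbf T(o\mid b,a)>0$; (2) $\mathrm{supp}(b)$ is $\{\top\}$ or $\{\bot\}$: leaf; (3) $0<b(q)<\eta$ for some $q$: cut node, whose only child is labelled by $b$ with all values smaller than $\eta$ replaced by $0$; (4) $\mathrm{supp}(b)$ belongs to a distinguishing maximal SEC $f$: sum node, with one child labelled $\frac{\|b\|_1}{\|b|_C\|_1}\,b|_C$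 and edge weight $\frac{\|b|_C\|_1}{\|b\|_1}$ for each class $C$ of $\equiv_{f,\mathrm{supp}(b)}$, where $b|_C$ is the restriction of $b$ to $C$; (5) $\mathrm{supp}(b)$ belongs to a non-distinguishing maximal SEC $f$: max node, with one child labelled $(b',a)$ for each $b'\in\mathrm{Reach}_f(b)$ and $a\notin f(\mathrm{supp}(b'))$; (6) otherwise: max node, with one child labelled $(b,a)$ for each $a\in A$. Let $\widehat T_n(b)$ be the truncation at depth $n$ of the tree with root labelled $b$. At a leaf $x$, $\mathrm{extVal}_n(x)$ is $\|\mathrm{belief}(x)\|_1$ if $\mathrm{supp}(\mathrm{belief}(x))=\{\top\}$ and $0$ otherwise, and $\mathrm{extRank}_n(x)=\mathrm{rank}(\mathrm{belief}(x))$. At a sum node both are the weighted sums over the children, at a cut node the values of the child, and at a max node the maxima over the children. Theorem. For every posterior-deterministic POMDP as above, every $\eta>0$, every initial sub-belief $b$ (in particular every belief), every $n\in\mathbb N$ and every node $x$ of $\widehat T_n(b)$, $$\mathrm{extVal}_n(x)\ \le\ \mathrm{Val}(x)\ \le\ \mathrm{extVal}_n(x)+\mathrm{extRank}_n(x)+|\mathrm{supp}(\mathrm{belief}(x))|\cdot\eta,$$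 where $\mathrm{Val}(x)=\mathrm{Val}(b')$ if $x$ is labelled by a sub-belief $b'$, and $\mathrm{Val}(x)=\mathrm{Val}(b',a)$ if $x$ is labelled by a pair $(b',a)$. Moreover $\mathrm{extVal}_n(x)\le \mathrm{Val}(\mathrm{belief}(x))$ for every node $x$. -/

import Mathlib

open MeasureTheory ProbabilityTheory

universe u

/-- A partially observable Markov decision process with states `Q`, actions `A`, observations `O`:
`T q a o q'` is the probability of receiving `o` and moving to `q'` when taking `a` in `q`. -/
structure POMDP (Q A O : Type u) [Fintype Q] [Fintype A] [Fintype O] where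
  T : Q → A → O → Q → ℝ
  T_nonneg : ∀ q a o q', 0 ≤ T q a o q'
  T_sum : ∀ q a, ∑ o, ∑ q', T q a o q' = 1

/-- One step `a o q` of a run: an action, an observation, and the state reached. -/
@[ext] structure Step (Q A O : Type u) where
  act : A
  obs : O
  state : Q

/-- A strategy maps every observable history to a probability distribution on actions. -/
structure Strategy (A O : Type u) [Fintype A] where
  prob : List (A × O) → A → ℝ
  prob_nonneg : ∀ h a, 0 ≤ prob h a
  prob_sum : ∀ h, ∑ a, prob h a = 1

/-- A run `q₀ a₁ o₁ q₁ a₂ o₂ q₂ …`, as the initial state and the sequence of steps. -/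
@[ext] structure Run (Q A O : Type u) where
  start : Q
  steps : ℕ → Step Q A O

/-- The `i`-th state of a run. -/
def Run.state {Q A O : Type u} (ρ : Run Q A O) : ℕ → Q
  | 0 => ρ.start
  | i + 1 => (ρ.steps i).state

/-- The last state of the history `q, l`. -/
def lastState {Q A O : Type u} (q : Q) (l : List (Step Q A O)) : Q :=
  l.foldl (fun _ s => s.state) q

/-- The observable part of a history. -/
def obsPart {Q A O : Type u} (l : List (Step Q A O)) : List (A × O) :=
  l.map fun s => (s.act, s.obs)

/-- The cylinder of all runs that start with the history `q, l`. -/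
def cyl {Q A O : Type u} (q : Q) (l : List (Step Q A O)) : Set (Run Q A O) :=
  {ρ | ρ.start = q ∧ List.ofFn (fun i : Fin l.length => ρ.steps i) = l}

/-- The σ-algebra on runs generated by the cylinders. -/
instance {Q A O : Type u} : MeasurableSpace (Run Q A O) :=
  MeasurableSpace.generateFrom {s | ∃ q l, s = cyl q l}

instance {Q A O : Type u} : MeasurableSpace (Step Q A O) := ⊤

instance {Q A O : Type u} : DiscreteMeasurableSpace (Step Q A O) := ⟨fun _ => trivial⟩

/-- Steps as triples. -/
def stepEquiv (Q A O : Type u) : Step Q A O ≃ A × O × Q where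
  toFun s := (s.act, s.obs, s.state)
  invFun p := ⟨p.1, p.2.1, p.2.2⟩
  left_inv _ := rfl
  right_inv _ := rfl

noncomputable instance {Q A O : Type u} [Fintype Q] [Fintype A] [Fintype O] :
    Fintype (Step Q A O) := Fintype.ofEquiv _ (stepEquiv Q A O).symm

/-- The runs that visit the set `G` of target states. -/
def reach {Q A O : Type u} (G : Set Q) : Set (Run Q A O) := {ρ | ∃ i, ρ.state i ∈ G}

theorem measurableSet_cyl {Q A O : Type u} (q : Q) (l : List (Step Q A O)) : MeasurableSet (cyl q l) :=
  MeasurableSpace.measurableSet_generateFrom ⟨q, l, rfl⟩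

theorem measurable_mkRun {Q A O : Type u} (q : Q) :
    Measurable (fun w => (⟨q, w⟩ : Run Q A O)) := by
  refine measurable_generateFrom ?_
  rintro _ ⟨q', l, rfl⟩
  by_cases h : q = q'
  · have : (fun w => (⟨q, w⟩ : Run Q A O)) ⁻¹' cyl q' l =
        ⋂ i : Fin l.length, (fun w : ℕ → Step Q A O => w i) ⁻¹' {l[i]} := by
      ext w
      simp only [cyl, h, Set.mem_preimage, Set.mem_ofPred_eq, true_and, Set.mem_iInter,
        Set.mem_singleton_iff]
      constructor
      · intro hw i
        conv_rhs => rw [Fin.getElem_fin]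
        have := List.getElem_of_eq hw (i := i) (by simp)
        simpa using this
      · intro hw
        apply List.ext_getElem (by simp)
        intro i h1 h2
        simpa using hw ⟨i, h2⟩
    rw [this]
    exact MeasurableSet.iInter fun i => measurable_pi_apply _ (MeasurableSet.singleton _)
  · have : (fun w => (⟨q, w⟩ : Run Q A O)) ⁻¹' cyl q' l = ∅ := by
      ext w; simp [cyl, h]
    rw [this]; exact MeasurableSet.empty

/-- The first `l.length` steps are `l`. -/
def stepsCyl {Q A O : Type u} (l : List (Step Q A O)) : Set (ℕ → Step Q A O) :=
  {w | List.ofFn (fun i : Fin l.length => w i) = l}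

theorem mem_stepsCyl_snoc {Q A O : Type u} (l : List (Step Q A O)) (s : Step Q A O) (w : ℕ → Step Q A O) :
    w ∈ stepsCyl (l ++ [s]) ↔ w ∈ stepsCyl l ∧ w l.length = s := by
  simp only [stepsCyl, Set.mem_ofPred_eq]
  rw [List.ofFn_congr (show (l ++ [s]).length = l.length + 1 by simp), List.ofFn_succ',
    List.concat_eq_append]
  constructor
  · intro h
    have h' := List.append_inj' h rfl
    exact ⟨h'.1, by simpa using h'.2⟩
  · rintro ⟨h1, h2⟩
    congr 1
    simpa using h2

namespace POMDP

variable {Q A O : Type u} [Fintype Q] [Fintype A] [Fintype O] (P : POMDP Q A O)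

/-! ### The probability measure on runs -/

/-- The law of the next step after the history `q, l` under the strategy `σ`. -/
noncomputable def stepMeasure (σ : Strategy A O) (q : Q) (l : List (Step Q A O)) :
    Measure (Step Q A O) :=
  ∑ s : Step Q A O,
    ENNReal.ofReal (σ.prob (obsPart l) s.act * P.T (lastState q l) s.act s.obs s.state) •
      Measure.dirac s

theorem stepMeasure_singleton (σ : Strategy A O) (q : Q) (l : List (Step Q A O))
    (s : Step Q A O) :
    P.stepMeasure σ q l {s} =
      ENNReal.ofReal (σ.prob (obsPart l) s.act * P.T (lastState q l) s.act s.obs s.state) := by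
  classical
  simp only [stepMeasure, Measure.finsetSum_apply, Measure.smul_apply, smul_eq_mul]
  rw [Finset.sum_eq_single s]
  · simp
  · intro t _ hts
    simp [hts]
  · simp

instance isProbabilityMeasure_stepMeasure (σ : Strategy A O) (q : Q) (l : List (Step Q A O)) :
    IsProbabilityMeasure (P.stepMeasure σ q l) := by
  constructor
  simp only [stepMeasure, Measure.finsetSum_apply, Measure.smul_apply, smul_eq_mul,
    measure_univ, mul_one]
  rw [← ENNReal.ofReal_sum_of_nonneg
    (fun s _ => mul_nonneg (σ.prob_nonneg _ _) (P.T_nonneg _ _ _ _))]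
  have key := Fintype.sum_equiv (stepEquiv Q A O)
    (fun s => σ.prob (obsPart l) s.act * P.T (lastState q l) s.act s.obs s.state)
    (fun p => σ.prob (obsPart l) p.1 * P.T (lastState q l) p.1 p.2.1 p.2.2) (fun _ => rfl)
  rw [key]
  simp only [Fintype.sum_prod_type, ← Finset.mul_sum, P.T_sum, mul_one, σ.prob_sum,
    ENNReal.ofReal_one]

/-- The transition kernels of the process of steps, started in the state `q`. -/
noncomputable def stepKernel (σ : Strategy A O) (q : Q) (n : ℕ) :
    Kernel (Π _ : Finset.Iic n, Step Q A O) (Step Q A O) :=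
  Kernel.ofFunOfCountable fun w =>
    P.stepMeasure σ q
      (List.ofFn fun i : Fin (n + 1) => w ⟨i, Finset.mem_Iic.2 (Nat.lt_succ_iff.1 i.2)⟩)

instance (σ : Strategy A O) (q : Q) (n : ℕ) : IsMarkovKernel (P.stepKernel σ q n) :=
  ⟨fun _ => P.isProbabilityMeasure_stepMeasure σ q _⟩

/-- The law of the sequence of steps, started in the state `q`. -/
noncomputable def stepsMeasure (σ : Strategy A O) (q : Q) : Measure (ℕ → Step Q A O) :=
  Kernel.trajMeasure (X := fun _ => Step Q A O) (P.stepMeasure σ q []) (P.stepKernel σ q)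

/-- The measure on runs given by the initial (sub-)belief `b` and the strategy `σ`. -/
noncomputable def runMeasure (b : Q → ℝ) (σ : Strategy A O) : Measure (Run Q A O) :=
  ∑ q, ENNReal.ofReal (b q) • (P.stepsMeasure σ q).map (fun w => (⟨q, w⟩ : Run Q A O))

theorem stepsMeasure_nil (σ : Strategy A O) (q : Q) :
    P.stepsMeasure σ q (stepsCyl []) = 1 := by
  have : stepsCyl ([] : List (Step Q A O)) = Set.univ := by
    ext w; simp [stepsCyl]
  rw [this, stepsMeasure]
  exact measure_univ

theorem stepsMeasure_map_zero (σ : Strategy A O) (q : Q) :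
    (P.stepsMeasure σ q).map (fun w => w 0) = P.stepMeasure σ q [] := by
  have h1 : (P.stepsMeasure σ q).map (Preorder.frestrictLe (π := fun _ => Step Q A O) 0) =
      (P.stepMeasure σ q []).map
        (MeasurableEquiv.piUnique (fun _ : Finset.Iic 0 => Step Q A O)).symm := by
    rw [stepsMeasure, Kernel.trajMeasure, Measure.map_comp _ _ (by fun_prop),
      Kernel.traj_map_frestrictLe, Kernel.partialTraj_self]
    exact Measure.id_comp
  have h2 : (fun w : ℕ → Step Q A O => w 0) =
      (fun v : (Π _ : Finset.Iic 0, Step Q A O) => v ⟨0, by simp⟩) ∘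
        (Preorder.frestrictLe (π := fun _ => Step Q A O) 0) := by
    ext w <;> rfl
  rw [h2, ← Measure.map_map (by fun_prop) (by fun_prop), h1,
    Measure.map_map (by fun_prop) (by fun_prop)]
  exact Measure.map_id

theorem stepsMeasure_snoc (σ : Strategy A O) (q : Q) (l : List (Step Q A O)) (s : Step Q A O) :
    P.stepsMeasure σ q (stepsCyl (l ++ [s])) = P.stepsMeasure σ q (stepsCyl l) *
      ENNReal.ofReal (σ.prob (obsPart l) s.act * P.T (lastState q l) s.act s.obs s.state) := by
  rw [← P.stepMeasure_singleton]
  rcases Nat.eq_zero_or_pos l.length with h0 | hpos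
  · obtain rfl := List.length_eq_zero_iff.1 h0
    rw [P.stepsMeasure_nil, one_mul, ← P.stepsMeasure_map_zero,
      Measure.map_apply (by fun_prop) (MeasurableSet.singleton s)]
    congr 1
    ext w
    simp [stepsCyl]
  · obtain ⟨n, hn⟩ : ∃ n, l.length = n + 1 := ⟨l.length - 1, by omega⟩
    let E : Set (Π _ : Finset.Iic n, Step Q A O) :=
      {w | (List.ofFn fun i : Fin (n + 1) =>
        w ⟨i, Finset.mem_Iic.2 (Nat.lt_succ_iff.1 i.2)⟩) = l}
    have hE : MeasurableSet E := (Set.to_countable E).measurableSet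
    have e1 : stepsCyl l = Preorder.frestrictLe (π := fun _ => Step Q A O) n ⁻¹' E := by
      ext w
      simp only [stepsCyl, Set.mem_ofPred_eq, Set.mem_preimage, E, Preorder.frestrictLe_apply]
      rw [List.ofFn_congr hn]
      simp
    have e2 : stepsCyl (l ++ [s]) =
        (fun w : ℕ → Step Q A O =>
          (Preorder.frestrictLe (π := fun _ => Step Q A O) n w, w (n + 1))) ⁻¹' (E ×ˢ {s}) := by
      ext w
      have : w ∈ stepsCyl l ↔ Preorder.frestrictLe (π := fun _ => Step Q A O) n w ∈ E := by
        rw [e1]; rfl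
      rw [Set.mem_preimage, Set.mem_prod, ← this]
      rw [mem_stepsCyl_snoc, hn]
      rfl
    have hk := Kernel.map_frestrictLe_trajMeasure_compProd_eq_map_trajMeasure
      (X := fun _ => Step Q A O) (μ₀ := P.stepMeasure σ q []) (κ := P.stepKernel σ q) (a := n)
    rw [e2, ← Measure.map_apply (by fun_prop) (hE.prod (MeasurableSet.singleton s)), stepsMeasure,
      ← hk, Measure.compProd_apply_prod hE (MeasurableSet.singleton s)]
    rw [setLIntegral_congr_fun hE (g := fun _ => P.stepMeasure σ q l {s}) ?_]
    · rw [setLIntegral_const, mul_comm, Measure.map_apply (by fun_prop) hE, e1]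
    · intro w hw
      have hw' : (List.ofFn fun i : Fin (n + 1) =>
        w ⟨i, Finset.mem_Iic.2 (Nat.lt_succ_iff.1 i.2)⟩) = l := hw
      change P.stepMeasure σ q _ {s} = _
      rw [hw']

theorem runMeasure_cyl (b : Q → ℝ) (σ : Strategy A O) (q : Q) (l : List (Step Q A O)) :
    P.runMeasure b σ (cyl q l) = ENNReal.ofReal (b q) * P.stepsMeasure σ q (stepsCyl l) := by
  simp only [runMeasure, Measure.finsetSum_apply, Measure.smul_apply, smul_eq_mul]
  rw [Finset.sum_eq_single q]
  · rw [Measure.map_apply (measurable_mkRun q) (measurableSet_cyl q l)]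
    congr 2
    ext w; simp [cyl, stepsCyl]
  · intro q' _ hq
    rw [Measure.map_apply (measurable_mkRun q') (measurableSet_cyl q l)]
    have : (fun w => (⟨q', w⟩ : Run Q A O)) ⁻¹' cyl q l = ∅ := by
      ext w; simp [cyl, hq]
    rw [this, measure_empty, mul_zero]
  · simp

/-- A history with a single state has probability `b q`. -/
theorem runMeasure_cyl_nil (b : Q → ℝ) (σ : Strategy A O) (q : Q) :
    P.runMeasure b σ (cyl q []) = ENNReal.ofReal (b q) := by
  rw [runMeasure_cyl, stepsMeasure_nil, mul_one]

/-- The inductive formula for the probability of the history `h' a o q`. -/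
theorem runMeasure_cyl_snoc (b : Q → ℝ) (σ : Strategy A O) (q : Q) (l : List (Step Q A O))
    (s : Step Q A O) :
    P.runMeasure b σ (cyl q (l ++ [s])) = P.runMeasure b σ (cyl q l) *
      ENNReal.ofReal (σ.prob (obsPart l) s.act * P.T (lastState q l) s.act s.obs s.state) := by
  rw [runMeasure_cyl, runMeasure_cyl, stepsMeasure_snoc, mul_assoc]

/-! ### Beliefs, value -/

/-- Sub-beliefs; beliefs are those of total mass `1`. -/
def IsSubBelief (b : Q → ℝ) : Prop := (∀ q, 0 ≤ b q) ∧ ∑ q, b q ≤ 1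

/-- The total mass of a sub-belief (its 1-norm). -/
def mass (b : Q → ℝ) : ℝ := ∑ q, b q

open Classical in
/-- The support of a (sub-)belief. -/
noncomputable def supp (b : Q → ℝ) : Finset Q := Finset.univ.filter fun q => 0 < b q

open Classical in
/-- The belief concentrated in `q`. -/
noncomputable def dirac (q : Q) : Q → ℝ := fun q' => if q' = q then 1 else 0

open Classical in
/-- The restriction of `b` to a set of states. -/
noncomputable def restrict (b : Q → ℝ) (C : Finset Q) : Q → ℝ := fun q => if q ∈ C then b q else 0

/-- The probability of observing `o` after taking `a` in the state `q`. -/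
def stateObsProb (q : Q) (a : A) (o : O) : ℝ := ∑ q', P.T q a o q'

/-- The probability of observing `o` after taking `a` from `b`. -/
def obsProb (b : Q → ℝ) (a : A) (o : O) : ℝ := ∑ q, P.stateObsProb q a o * b q

/-- The belief after taking `a` from `b` and observing `o`. -/
noncomputable def update (b : Q → ℝ) (a : A) (o : O) : Q → ℝ := fun q =>
  (∑ q', b q' * P.T q' a o q) / ∑ q'', ∑ q', b q' * P.T q' a o q''

/-- The reachability value of `b` with respect to the target set `G`. -/
noncomputable def val (G : Set Q) (b : Q → ℝ) : ℝ :=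
  ⨆ σ : Strategy A O, (P.runMeasure b σ).real (reach G)

/-- The value of `b` when the first action is `a`. -/
noncomputable def valAct (G : Set Q) (b : Q → ℝ) (a : A) : ℝ :=
  ∑ o, P.obsProb b a o * P.val G (P.update b a o)

/-! ### Assumptions on the POMDP -/

/-- From a state, an action and an observation there is at most one successor state. -/
def PosteriorDeterministic : Prop :=
  ∀ q a o q₁ q₂, 0 < P.T q a o q₁ → 0 < P.T q a o q₂ → q₁ = q₂

/-- Once in `q`, the process remains in `q`. -/
def Absorbing (q : Q) : Prop := ∀ a o q', 0 < P.T q a o q' → q' = q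

/-- Whenever `q` is reached, a specific observation is received, which identifies `q`. -/
def Observable (q : Q) : Prop :=
  ∃ o₀, ∀ q₁ a o q', 0 < P.T q₁ a o q' → (o = o₀ ↔ q' = q)

/-! ### Belief supports and support end components -/

open Classical in
/-- The set of possible successors of the states of `S` under `a` and `o`. -/
noncomputable def delta (S : Finset Q) (a : A) (o : O) : Finset Q :=
  Finset.univ.filter fun q' => ∃ q ∈ S, 0 < P.T q a o q'

/-- The extension of `delta` to observable histories. -/
noncomputable def deltaStar (S : Finset Q) (h : List (A × O)) : Finset Q :=
  h.foldl (fun S x => P.delta S x.1 x.2) S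

/-- A partial function from belief supports to sets of actions with non-empty values: it is defined
at `S` if and only if `f S` is non-empty. -/
abbrev ActionMap (Q A : Type u) := Finset Q → Set A

/-- The domain. -/
def dom (f : ActionMap Q A) : Set (Finset Q) := {S | (f S).Nonempty}

/-- The possible observable histories from the support `S` all of whose actions are allowed
by `f`. -/
def Inside (f : ActionMap Q A) : Finset Q → List (A × O) → Prop
  | _, [] => True
  | S, x :: h => x.1 ∈ f S ∧ (P.delta S x.1 x.2).Nonempty ∧ Inside f (P.delta S x.1 x.2) h

/-- The supports that can be reached from `S` by using actions allowed by `f`. -/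
def reachSupp (f : ActionMap Q A) (S : Finset Q) : Set (Finset Q) :=
  {T | ∃ h, P.Inside f S h ∧ P.deltaStar S h = T}

/-- The (sub-)beliefs that can be reached from `b` by using actions allowed by `f`; the total mass
is that of `b`. -/
inductive ReachBelief (f : ActionMap Q A) (b : Q → ℝ) : (Q → ℝ) → Prop
  | refl : ReachBelief f b b
  | step (c : Q → ℝ) (a : A) (o : O) : ReachBelief f b c → a ∈ f (supp c) →
      0 < P.obsProb c a o → ReachBelief f b (mass b • P.update c a o)

/-- Support end components. -/
structure IsSEC (f : ActionMap Q A) : Prop where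
  nonempty_of_mem : ∀ S ∈ dom f, S.Nonempty
  closed : ∀ S ∈ dom f, ∀ a ∈ f S, ∀ o, (P.delta S a o).Nonempty → P.delta S a o ∈ dom f
  connected : ∀ S ∈ dom f, ∀ T ∈ dom f, T ∈ P.reachSupp f S

/-- `f` is a maximal support end component (for containment, which is the pointwise order) and
`S` belongs to its domain. -/
def IsMaximalSECAt (S : Finset Q) (f : ActionMap Q A) : Prop := Maximal P.IsSEC f ∧ S ∈ dom f

/-- `(f, S)`-indistinguishability. In a posterior-deterministic POMDP, for `q ∈ S` and `h` inside a
support end component `f`, the set `deltaStar {q} h` consists of the single state `δ*(q, h)`. -/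
def Indist (f : ActionMap Q A) (S : Finset Q) (q q' : Q) : Prop :=
  ∀ h, P.Inside f S h → ∀ r ∈ P.deltaStar {q} h, ∀ r' ∈ P.deltaStar {q'} h,
    ∀ a ∈ f (P.deltaStar S h), ∀ o, P.stateObsProb r a o = P.stateObsProb r' a o

/-- Some support of `f` contains two distinguishable states. -/
def Distinguishing (f : ActionMap Q A) : Prop :=
  ∃ S ∈ dom f, ∃ q ∈ S, ∃ q' ∈ S, ¬ P.Indist f S q q'

open Classical in
/-- The equivalence classes of `(f, S)`-indistinguishability on `S`. -/
noncomputable def classes (f : ActionMap Q A) (S : Finset Q) : Finset (Finset Q) :=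
  S.image fun q => S.filter fun q' => P.Indist f S q q'

/-! ### The rank -/

/-- `T ⪯ S`: the support `T` can be reached from the support `S`. -/
def suppLe (T S : Finset Q) : Prop := ∃ h, P.deltaStar S h = T

/-- The extension of `⪯` by the comparison of cardinalities. -/
def suppLeTot (S T : Finset Q) : Prop := P.suppLe S T ∨ S.card < T.card

/-- The strict part of `suppLeTot`. -/
def suppLtTot (S T : Finset Q) : Prop := P.suppLeTot S T ∧ ¬ P.suppLeTot T S

/-- The rank of a belief support `S`: the height of its class in the order induced by `suppLeTot`,
that is, the greatest `k` such that there is a strict chain `c 0 < ⋯ < c k = S`. -/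
noncomputable def rankSupp (S : Finset Q) : ℕ :=
  sSup {k | ∃ c : ℕ → Finset Q, (∀ i ≤ k, (c i).Nonempty) ∧
    (∀ i < k, P.suppLtTot (c i) (c (i + 1))) ∧ c k = S}

/-- The rank of a (sub-)belief. -/
noncomputable def rank (b : Q → ℝ) : ℝ := mass b * P.rankSupp (supp b)

/-! ### The unfolding tree -/

open Classical in
/-- Removal of the probabilities below the threshold. -/
noncomputable def cutBelief (η : ℝ) (b : Q → ℝ) : Q → ℝ := fun q => if b q < η then 0 else b q

end POMDP

/-- The labels of the nodes: a (sub-)belief, or a (sub-)belief and an action. -/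
inductive NodeLabel (Q A : Type u) where
  | belief (b : Q → ℝ)
  | beliefAct (b : Q → ℝ) (a : A)

/-- The (sub-)belief in a label. -/
def NodeLabel.toBelief {Q A : Type u} : NodeLabel Q A → Q → ℝ
  | .belief b => b
  | .beliefAct b _ => b

/-- Finite-depth trees with labelled nodes. The inner nodes are sum nodes (with an edge weight for
each child), cut nodes (with one child) and max nodes. -/
inductive UnfTree (Q A : Type u) where
  | leaf (x : NodeLabel Q A)
  | sum (x : NodeLabel Q A) (ι : Type u) [Fintype ι] (w : ι → ℝ) (child : ι → UnfTree Q A)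
  | cut (x : NodeLabel Q A) (child : UnfTree Q A)
  | max (x : NodeLabel Q A) (ι : Type u) (child : ι → UnfTree Q A)

namespace UnfTree

variable {Q A O : Type u} [Fintype Q] [Fintype A] [Fintype O]

/-- The label of the root. -/
def label : UnfTree Q A → NodeLabel Q A
  | leaf x => x
  | sum x _ _ _ => x
  | cut x _ => x
  | max x _ _ => x

/-- `Node t x`: `x` is a node of `t`. A node is identified with the subtree rooted at it. -/
inductive Node : UnfTree Q A → UnfTree Q A → Prop
  | root (t) : Node t t
  | sum (x) (ι : Type u) [Fintype ι] (w : ι → ℝ) (child) (i : ι) (y) :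
      Node (child i) y → Node (.sum x ι w child) y
  | cut (x) (child) (y) : Node child y → Node (.cut x child) y
  | max (x) (ι : Type u) (child) (i : ι) (y) : Node (child i) y → Node (.max x ι child) y

open Classical in
/-- The lower estimate. The children of the max nodes of the unfolding tree are finitely many. -/
noncomputable def extVal (top : Q) : UnfTree Q A → ℝ
  | leaf x => if POMDP.supp x.toBelief = {top} then POMDP.mass x.toBelief else 0
  | sum _ _ w child => ∑ i, w i * extVal top (child i)
  | cut _ child => extVal top child
  | max _ _ child => ⨆ i, extVal top (child i)

/-- The error estimate. -/
noncomputable def extRank (P : POMDP Q A O) : UnfTree Q A → ℝ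
  | leaf x => P.rank x.toBelief
  | sum _ _ w child => ∑ i, w i * extRank P (child i)
  | cut _ child => extRank P child
  | max _ _ child => ⨆ i, extRank P (child i)

end UnfTree

namespace POMDP

variable {Q A O : Type u} [Fintype Q] [Fintype A] [Fintype O] (P : POMDP Q A O)

/-- The value of a label: `val` of a (sub-)belief, `valAct` of a (sub-)belief and an action. -/
noncomputable def valLabel (G : Set Q) : NodeLabel Q A → ℝ
  | .belief b => P.val G b
  | .beliefAct b a => P.valAct G b a

open Classical in
/-- The truncation at depth `n` of the smart unfolding tree whose root is labelled by `x`, with cut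
threshold `η`: each node is unfolded by the first applicable rule. -/
noncomputable def unfold (top bot : Q) (η : ℝ) : ℕ → NodeLabel Q A → UnfTree Q A
  | 0, x => .leaf x
  | n + 1, .beliefAct b a =>
      .sum (.beliefAct b a) {o // 0 < P.obsProb b a o}
        (fun o => P.obsProb b a o)
        (fun o => unfold top bot η n (.belief (P.update b a o)))
  | n + 1, .belief b =>
      if supp b = {top} ∨ supp b = {bot} then .leaf (.belief b)
      else if ∃ q, b q ≠ 0 ∧ b q < η then
        .cut (.belief b) (unfold top bot η n (.belief (cutBelief η b)))
      else if h : ∃ f, P.IsMaximalSECAt (supp b) f then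
        if P.Distinguishing h.choose then
          .sum (.belief b) {C // C ∈ P.classes h.choose (supp b)}
            (fun C => mass (restrict b C) / mass b)
            (fun C => unfold top bot η n
              (.belief ((mass b / mass (restrict b C)) • restrict b C)))
        else
          .max (.belief b)
            {p : (Q → ℝ) × A // P.ReachBelief h.choose b p.1 ∧ p.2 ∉ h.choose (supp p.1)}
            (fun p => unfold top bot η n (.beliefAct p.1.1 p.1.2))
      else
        .max (.belief b) A (fun a => unfold top bot η n (.beliefAct b a))

end POMDP

set_option linter.unusedSectionVars false

/-! The two inequalities are proved together for every node, by induction on the depth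
(`isEstimate_of_node`), so it suffices that each unfolding rule propagates them from the children to
the parent. The value is positively homogeneous, subadditive and monotone in the sub-belief and
bounded by its mass. Since `top` is absorbing, it satisfies the Bellman inequalities
`sum_val_push_le` and `val_le_of_valAct_le`. By posterior-determinism an observation acts on states
as a partial map, so supports never grow in size and the error term `|supp| * η` never increases
towards the children.

At a leaf the value is at most the mass, and the rank of a support other than `{top}` and `{bot}` is
at least `1` (`one_le_rankSupp`). This is the only lower bound on ranks that is needed. At a cut
node each removed state carries mass less than `η` and leaves the support, so the drop in `|supp| *
η` pays for it (`card_supp_cutBelief`). Sum nodes labelled by a pair and ordinary max nodes are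
Bellman's equation.

The remaining rules rest on rigidity of support end components: all supports have the same size, so
histories act injectively, and every history can be continued to one acting as the identity
(`exists_return`). If the states are indistinguishable, observations do not reweight the belief, and
a minimum principle shows that the value is constant along all histories (`val_transport_eq`).
Staying forever never reaches `top`, so the value is governed by the exits (`InNondist.val_le`).

If the component is distinguishing, the value is the sum of the values of the restrictions to the
classes (`sum_val_restrict_classes`). The loss from not knowing the class is the `gap`. It is at
most the `affinity` of the class weights, a sum of geometric means. Playing a distinguishing history
shrinks this expected affinity through a Bhattacharyya coefficient less than `1`. By finiteness the
contraction factor is uniform, so iterating shows that the gap is not positive. -/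

/-! ### Finite-horizon reachability probabilities -/

/-- The residual strategy after the observable step `(a, o)`. -/
def Strategy.shift {A O : Type u} [Fintype A] (σ : Strategy A O) (a : A) (o : O) :
    Strategy A O where
  prob h := σ.prob ((a, o) :: h)
  prob_nonneg _ := σ.prob_nonneg _
  prob_sum _ := σ.prob_sum _

theorem mem_stepsCyl_ofFn {Q A O : Type u} {n : ℕ} (c : Fin n → Step Q A O)
    (w : ℕ → Step Q A O) : w ∈ stepsCyl (List.ofFn c) ↔ ∀ i : Fin n, w i = c i := by
  simp only [stepsCyl, Set.mem_ofPred_eq]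
  rw [List.ofFn_congr (List.length_ofFn (f := c)), List.ofFn_inj, funext_iff]
  simp

namespace POMDP

variable {Q A O : Type u} [Fintype Q] [Fintype A] [Fintype O] (P : POMDP Q A O)

/-- The probability of the history `q, l` when starting from the state `q`. -/
noncomputable def pathProb : Strategy A O → Q → List (Step Q A O) → ℝ
  | _, _, [] => 1
  | σ, q, s :: l =>
      σ.prob [] s.act * P.T q s.act s.obs s.state * pathProb (σ.shift s.act s.obs) s.state l

theorem pathProb_nonneg (σ : Strategy A O) (q : Q) (l : List (Step Q A O)) :
    0 ≤ P.pathProb σ q l := by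
  induction l generalizing σ q with
  | nil => exact zero_le_one
  | cons s l ih =>
    exact mul_nonneg (mul_nonneg (σ.prob_nonneg _ _) (P.T_nonneg _ _ _ _)) (ih _ _)

/-- `pathProb` peels off the first step, as Bellman's equation requires, whereas the measure on runs
is built by appending a last step. This identity reconciles the two recursions. -/
theorem pathProb_snoc (σ : Strategy A O) (q : Q) (l : List (Step Q A O)) (s : Step Q A O) :
    P.pathProb σ q (l ++ [s]) = P.pathProb σ q l *
      (σ.prob (obsPart l) s.act * P.T (lastState q l) s.act s.obs s.state) := by
  induction l generalizing σ q with
  | nil => simp [pathProb, obsPart, lastState]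
  | cons t l ih =>
    simp only [List.cons_append, pathProb, ih]
    simp [obsPart, lastState, Strategy.shift, mul_assoc]

theorem stepsMeasure_stepsCyl (σ : Strategy A O) (q : Q) (l : List (Step Q A O)) :
    P.stepsMeasure σ q (stepsCyl l) = ENNReal.ofReal (P.pathProb σ q l) := by
  induction l using List.reverseRecOn with
  | nil => simp [P.stepsMeasure_nil, pathProb]
  | append_singleton l s ih =>
    rw [stepsMeasure_snoc, ih, pathProb_snoc, ENNReal.ofReal_mul (P.pathProb_nonneg _ _ _)]

instance isProbabilityMeasure_stepsMeasure (σ : Strategy A O) (q : Q) :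
    IsProbabilityMeasure (P.stepsMeasure σ q) := by
  unfold stepsMeasure; infer_instance

/-- The history `q, c` visits the target set. -/
def Visits (G : Set Q) (q : Q) {n : ℕ} (c : Fin n → Step Q A O) : Prop :=
  q ∈ G ∨ ∃ i, (c i).state ∈ G

open Classical in
/-- The probability that the target set is visited within `n` steps. -/
noncomputable def reachWithin (G : Set Q) (n : ℕ) (σ : Strategy A O) (q : Q) : ℝ :=
  ∑ c : Fin n → Step Q A O, if Visits G q c then P.pathProb σ q (List.ofFn c) else 0

theorem stepsMeasure_visits (G : Set Q) (n : ℕ) (σ : Strategy A O) (q : Q) :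
    P.stepsMeasure σ q {w | Visits G q (fun i : Fin n => w i)} =
      ENNReal.ofReal (P.reachWithin G n σ q) := by
  classical
  have h : {w : ℕ → Step Q A O | Visits G q (fun i : Fin n => w i)} =
      ⋃ c ∈ Finset.univ.filter (fun c : Fin n → Step Q A O => Visits G q c),
        stepsCyl (List.ofFn c) := by
    ext w
    simp only [Set.mem_ofPred_eq, Finset.mem_filter, Finset.mem_univ, true_and, Set.mem_iUnion,
      mem_stepsCyl_ofFn, exists_prop]
    constructor
    · intro hw
      exact ⟨_, hw, fun _ => rfl⟩
    · rintro ⟨c, hc, hw⟩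
      rwa [show (fun i : Fin n => w i) = c from funext hw]
  rw [h, measure_biUnion_finset]
  · simp only [stepsMeasure_stepsCyl]
    rw [← ENNReal.ofReal_sum_of_nonneg (fun _ _ => P.pathProb_nonneg _ _ _), reachWithin,
      Finset.sum_filter]
  · intro c _ c' _ hcc
    refine Set.disjoint_left.2 fun w hw hw' => hcc ?_
    rw [mem_stepsCyl_ofFn] at hw hw'
    exact funext fun i => (hw i).symm.trans (hw' i)
  · intro c _
    have : stepsCyl (List.ofFn c) = ⋂ i : Fin n, (fun w : ℕ → Step Q A O => w i) ⁻¹' {c i} := by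
      ext w; simp [mem_stepsCyl_ofFn]
    rw [this]
    exact MeasurableSet.iInter fun i => measurable_pi_apply _ (MeasurableSet.singleton _)

theorem reachWithin_nonneg (G : Set Q) (n : ℕ) (σ : Strategy A O) (q : Q) :
    0 ≤ P.reachWithin G n σ q := by
  classical
  refine Finset.sum_nonneg fun c _ => ?_
  split_ifs
  exacts [P.pathProb_nonneg _ _ _, le_rfl]

theorem reachWithin_eq (G : Set Q) (n : ℕ) (σ : Strategy A O) (q : Q) :
    P.reachWithin G n σ q =
      (P.stepsMeasure σ q).real {w | Visits G q (fun i : Fin n => w i)} := by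
  rw [Measure.real, stepsMeasure_visits, ENNReal.toReal_ofReal (P.reachWithin_nonneg _ _ _ _)]

theorem reachWithin_of_mem (G : Set Q) (n : ℕ) (σ : Strategy A O) {q : Q} (hq : q ∈ G) :
    P.reachWithin G n σ q = 1 := by
  rw [reachWithin_eq]
  have : {w : ℕ → Step Q A O | Visits G q (fun i : Fin n => w i)} = Set.univ := by
    ext w; simp [Visits, hq]
  simp [this]

theorem reachWithin_zero_of_notMem (G : Set Q) (σ : Strategy A O) {q : Q} (hq : q ∉ G) :
    P.reachWithin G 0 σ q = 0 := by
  classical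
  refine Finset.sum_eq_zero fun c _ => if_neg ?_
  rintro (h | ⟨i, _⟩)
  exacts [hq h, i.elim0]

theorem sum_step (g : Step Q A O → ℝ) :
    ∑ s, g s = ∑ a, ∑ o, ∑ q, g ⟨a, o, q⟩ := by
  rw [Fintype.sum_equiv (stepEquiv Q A O) g (fun p => g ⟨p.1, p.2.1, p.2.2⟩) (fun _ => rfl)]
  simp only [Fintype.sum_prod_type]

/-- Absorption is needed when `q = top`: the left side is then `1`, and the right side is `1`
because every successor is again `top`. For other states the first step can be split off freely. -/
theorem reachWithin_succ {top : Q} (htop : P.Absorbing top) (n : ℕ) (σ : Strategy A O) (q : Q) :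
    P.reachWithin {top} (n + 1) σ q = ∑ a, σ.prob [] a * ∑ o, ∑ q', P.T q a o q' *
      P.reachWithin {top} n (σ.shift a o) q' := by
  classical
  by_cases hq : q = top
  · subst hq
    rw [P.reachWithin_of_mem _ _ _ (Set.mem_singleton q)]
    have : ∀ a, ∑ o, ∑ q', P.T q a o q' * P.reachWithin {q} n (σ.shift a o) q' = 1 := by
      intro a
      rw [← P.T_sum q a]
      refine Finset.sum_congr rfl fun o _ => Finset.sum_congr rfl fun q' _ => ?_
      rcases (P.T_nonneg q a o q').eq_or_lt with h | h
      · simp [← h]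
      · rw [P.reachWithin_of_mem _ _ _ (Set.mem_singleton_iff.2 (htop a o q' h)), mul_one]
    simp [this, σ.prob_sum]
  · rw [reachWithin, ← (Fin.consEquiv (fun _ : Fin (n + 1) => Step Q A O)).sum_comp,
      Fintype.sum_prod_type, sum_step]
    refine Finset.sum_congr rfl fun a _ => ?_
    rw [Finset.mul_sum]
    refine Finset.sum_congr rfl fun o _ => ?_
    rw [Finset.mul_sum]
    refine Finset.sum_congr rfl fun q' _ => ?_
    rw [reachWithin, Finset.mul_sum, Finset.mul_sum]
    refine Finset.sum_congr rfl fun c _ => ?_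
    have hv : Visits {top} q (Fin.cons (α := fun _ => Step Q A O) ⟨a, o, q'⟩ c) ↔
        Visits {top} q' c := by
      simp [Visits, hq, Fin.exists_fin_succ]
    simp only [Fin.consEquiv, Equiv.coe_fn_mk, List.ofFn_cons, hv]
    split_ifs <;> simp [pathProb, mul_assoc]

/-! ### Reachability probabilities -/

/-- The probability to reach `G` from the state `q`. -/
noncomputable def reachProb (G : Set Q) (σ : Strategy A O) (q : Q) : ℝ :=
  (P.stepsMeasure σ q).real {w | ∃ i, Run.state ⟨q, w⟩ i ∈ G}

theorem reachProb_nonneg (G : Set Q) (σ : Strategy A O) (q : Q) : 0 ≤ P.reachProb G σ q :=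
  measureReal_nonneg

theorem reachProb_le_one (G : Set Q) (σ : Strategy A O) (q : Q) : P.reachProb G σ q ≤ 1 :=
  measureReal_le_one

theorem iUnion_visits (G : Set Q) (q : Q) :
    ⋃ n, {w : ℕ → Step Q A O | Visits G q (fun i : Fin n => w i)} =
      {w | ∃ i, Run.state ⟨q, w⟩ i ∈ G} := by
  ext w
  simp only [Set.mem_iUnion, Set.mem_ofPred_eq]
  constructor
  · rintro ⟨n, h | ⟨i, hi⟩⟩
    · exact ⟨0, h⟩
    · exact ⟨i + 1, hi⟩
  · rintro ⟨i, hi⟩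
    cases i with
    | zero => exact ⟨0, Or.inl hi⟩
    | succ i => exact ⟨i + 1, Or.inr ⟨Fin.last i, hi⟩⟩

theorem monotone_visits (G : Set Q) (q : Q) :
    Monotone fun n => {w : ℕ → Step Q A O | Visits G q (fun i : Fin n => w i)} := by
  intro m n hmn w
  rintro (h | ⟨i, hi⟩)
  · exact Or.inl h
  · exact Or.inr ⟨Fin.castLE hmn i, hi⟩

theorem tendsto_reachWithin (G : Set Q) (σ : Strategy A O) (q : Q) :
    Filter.Tendsto (fun n => P.reachWithin G n σ q) Filter.atTop
      (nhds (P.reachProb G σ q)) := by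
  simp only [reachWithin_eq, reachProb, Measure.real, ← iUnion_visits]
  exact (ENNReal.tendsto_toReal (measure_ne_top _ _)).comp
    (tendsto_measure_iUnion_atTop (monotone_visits G q))

theorem reachWithin_le_reachProb (G : Set Q) (n : ℕ) (σ : Strategy A O) (q : Q) :
    P.reachWithin G n σ q ≤ P.reachProb G σ q := by
  rw [reachWithin_eq, reachProb, ← iUnion_visits]
  exact measureReal_mono (Set.subset_iUnion
    (fun n => {w : ℕ → Step Q A O | Visits G q (fun i : Fin n => w i)}) n)

theorem reachProb_eq {top : Q} (htop : P.Absorbing top) (σ : Strategy A O) (q : Q) :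
    P.reachProb {top} σ q = ∑ a, σ.prob [] a * ∑ o, ∑ q', P.T q a o q' *
      P.reachProb {top} (σ.shift a o) q' := by
  refine tendsto_nhds_unique
    ((P.tendsto_reachWithin {top} σ q).comp (Filter.tendsto_add_atTop_nat 1)) ?_
  simp only [Function.comp_def, P.reachWithin_succ htop]
  exact tendsto_finsetSum _ fun a _ => (tendsto_finsetSum _ fun o _ =>
    tendsto_finsetSum _ fun q' _ => (P.tendsto_reachWithin _ _ _).const_mul _).const_mul _

theorem reachProb_of_mem (G : Set Q) (σ : Strategy A O) {q : Q} (hq : q ∈ G) :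
    P.reachProb G σ q = 1 :=
  le_antisymm (P.reachProb_le_one _ _ _)
    ((P.reachWithin_of_mem G 0 σ hq).symm.le.trans (P.reachWithin_le_reachProb G 0 σ q))

/-- A run meets `G` exactly when some finite prefix does, so the event is a countable union of the
generating cylinders. -/
theorem measurableSet_reach (G : Set Q) : MeasurableSet (reach (A := A) (O := O) G) := by
  have : reach (A := A) (O := O) G =
      ⋃ n : ℕ, ⋃ q : Q, ⋃ c : {c : Fin n → Step Q A O // Visits G q c},
        cyl q (List.ofFn c.1) := by
    ext ρ
    have h1 := Set.ext_iff.1 (iUnion_visits (A := A) (O := O) G ρ.start) ρ.steps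
    have h2 : ρ ∈ reach G ↔ ∃ i, Run.state ⟨ρ.start, ρ.steps⟩ i ∈ G := Iff.rfl
    rw [h2]
    refine h1.symm.trans ?_
    have h3 : ∀ (q : Q) {n : ℕ} (c : Fin n → Step Q A O),
        ρ ∈ cyl q (List.ofFn c) ↔ ρ.start = q ∧ ∀ i : Fin n, ρ.steps i = c i := by
      intro q n c
      rw [← mem_stepsCyl_ofFn]; rfl
    simp only [Set.mem_iUnion, Set.mem_ofPred_eq, h3]
    constructor
    · rintro ⟨n, hn⟩
      exact ⟨n, ρ.start, ⟨_, hn⟩, rfl, fun _ => rfl⟩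
    · rintro ⟨n, q, ⟨c, hc⟩, rfl, h⟩
      refine ⟨n, ?_⟩
      rwa [show (fun i : Fin n => ρ.steps i) = c from funext h]
  rw [this]
  exact MeasurableSet.iUnion fun n => MeasurableSet.iUnion fun q => MeasurableSet.iUnion fun c =>
    measurableSet_cyl _ _

theorem runMeasure_reach (G : Set Q) (b : Q → ℝ) (hb : ∀ q, 0 ≤ b q) (σ : Strategy A O) :
    (P.runMeasure b σ).real (reach G) = ∑ q, b q * P.reachProb G σ q := by
  simp only [Measure.real, runMeasure, Measure.finsetSum_apply, Measure.smul_apply, smul_eq_mul]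
  rw [ENNReal.toReal_sum]
  · refine Finset.sum_congr rfl fun q _ => ?_
    rw [ENNReal.toReal_mul, ENNReal.toReal_ofReal (hb q),
      Measure.map_apply (measurable_mkRun q) (measurableSet_reach G)]
    rfl
  · intro q _
    rw [Measure.map_apply (measurable_mkRun q) (measurableSet_reach G)]
    exact ENNReal.mul_ne_top ENNReal.ofReal_ne_top (measure_ne_top _ _)

end POMDP

namespace POMDP

variable {Q A O : Type u} [Fintype Q] [Fintype A] [Fintype O] (P : POMDP Q A O)

/-! ### The value function -/

/-- The unnormalized belief after taking `a` from `b` and observing `o`. -/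
def push (b : Q → ℝ) (a : A) (o : O) : Q → ℝ := fun q => ∑ q', b q' * P.T q' a o q

theorem push_nonneg {b : Q → ℝ} (hb : ∀ q, 0 ≤ b q) (a : A) (o : O) (q : Q) :
    0 ≤ P.push b a o q :=
  Finset.sum_nonneg fun _ _ => mul_nonneg (hb _) (P.T_nonneg _ _ _ _)

theorem mass_push (b : Q → ℝ) (a : A) (o : O) : mass (P.push b a o) = P.obsProb b a o := by
  simp only [mass, push, obsProb, stateObsProb]
  rw [Finset.sum_comm]
  refine Finset.sum_congr rfl fun q _ => ?_
  rw [Finset.sum_mul]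
  exact Finset.sum_congr rfl fun _ _ => mul_comm _ _

theorem update_eq (b : Q → ℝ) (a : A) (o : O) :
    P.update b a o = (P.obsProb b a o)⁻¹ • P.push b a o := by
  ext q
  rw [← mass_push]
  simp only [update, push, mass, Pi.smul_apply, smul_eq_mul]
  rw [div_eq_inv_mul]

theorem mass_nonneg {b : Q → ℝ} (hb : ∀ q, 0 ≤ b q) : 0 ≤ mass b :=
  Finset.sum_nonneg fun q _ => hb q

theorem eq_zero_of_mass_eq_zero {b : Q → ℝ} (hb : ∀ q, 0 ≤ b q) (h : mass b = 0) : b = 0 := by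
  ext q
  exact (Finset.sum_eq_zero_iff_of_nonneg fun q _ => hb q).1 h q (Finset.mem_univ q)

theorem mass_smul (c : ℝ) (b : Q → ℝ) : mass (c • b) = c * mass b := by
  simp [mass, Finset.mul_sum]

theorem mass_sum {ι : Type*} (s : Finset ι) (b : ι → Q → ℝ) :
    mass (∑ i ∈ s, b i) = ∑ i ∈ s, mass (b i) := by
  simp only [mass, Finset.sum_apply]
  exact Finset.sum_comm

theorem sum_nonneg_apply {ι : Type*} {s : Finset ι} {b : ι → Q → ℝ}
    (hb : ∀ i ∈ s, ∀ q, 0 ≤ b i q) (q : Q) : 0 ≤ (∑ i ∈ s, b i) q := by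
  rw [Finset.sum_apply]
  exact Finset.sum_nonneg fun i hi => hb i hi q

theorem smul_nonneg_apply {c : ℝ} (hc : 0 ≤ c) {b : Q → ℝ} (hb : ∀ q, 0 ≤ b q) (q : Q) :
    0 ≤ (c • b) q :=
  mul_nonneg hc (hb q)

theorem sum_stateObsProb (q : Q) (a : A) : ∑ o, P.stateObsProb q a o = 1 := P.T_sum q a

theorem stateObsProb_nonneg (q : Q) (a : A) (o : O) : 0 ≤ P.stateObsProb q a o :=
  Finset.sum_nonneg fun _ _ => P.T_nonneg _ _ _ _

theorem sum_obsProb (b : Q → ℝ) (a : A) : ∑ o, P.obsProb b a o = mass b := by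
  simp only [obsProb]
  rw [Finset.sum_comm]
  simp only [← Finset.sum_mul, sum_stateObsProb, one_mul, mass]

theorem obsProb_nonneg {b : Q → ℝ} (hb : ∀ q, 0 ≤ b q) (a : A) (o : O) : 0 ≤ P.obsProb b a o :=
  Finset.sum_nonneg fun _ _ => mul_nonneg (P.stateObsProb_nonneg _ _ _) (hb _)

theorem obsProb_smul_update {b : Q → ℝ} (hb : ∀ q, 0 ≤ b q) (a : A) (o : O) :
    P.obsProb b a o • P.update b a o = P.push b a o := by
  rw [update_eq]
  -- For an impossible observation the division in `update` returns `0`, and `push` is also `0`,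
  -- being nonnegative of mass `0`.
  by_cases h : P.obsProb b a o = 0
  · rw [← mass_push] at h
    rw [eq_zero_of_mass_eq_zero (P.push_nonneg hb a o) h]
    simp
  · rw [smul_inv_smul₀ h]

theorem update_nonneg {b : Q → ℝ} (hb : ∀ q, 0 ≤ b q) (a : A) (o : O) (q : Q) :
    0 ≤ P.update b a o q := by
  rw [update_eq]
  exact mul_nonneg (inv_nonneg.2 (P.obsProb_nonneg hb a o)) (P.push_nonneg hb a o q)

theorem mass_update {b : Q → ℝ} {a : A} {o : O} (h : 0 < P.obsProb b a o) :
    mass (P.update b a o) = 1 := by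
  rw [update_eq, mass_smul, mass_push, inv_mul_cancel₀ h.ne']

instance [Nonempty A] : Nonempty (Strategy A O) := by
  classical
  obtain ⟨a⟩ := ‹Nonempty A›
  exact ⟨⟨fun _ a' => if a' = a then 1 else 0, fun _ _ => by positivity, fun _ => by simp⟩⟩

/-- The probability to reach `G` from `b` under `σ`. -/
noncomputable def reachFrom (G : Set Q) (b : Q → ℝ) (σ : Strategy A O) : ℝ :=
  ∑ q, b q * P.reachProb G σ q

theorem reachFrom_smul (G : Set Q) (c : ℝ) (b : Q → ℝ) (σ : Strategy A O) :
    P.reachFrom G (c • b) σ = c * P.reachFrom G b σ := by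
  simp [reachFrom, Finset.mul_sum, mul_assoc]

theorem reachFrom_sum (G : Set Q) {ι : Type*} (s : Finset ι) (b : ι → Q → ℝ) (σ : Strategy A O) :
    P.reachFrom G (∑ i ∈ s, b i) σ = ∑ i ∈ s, P.reachFrom G (b i) σ := by
  simp only [reachFrom, Finset.sum_apply, Finset.sum_mul]
  exact Finset.sum_comm

theorem reachFrom_nonneg (G : Set Q) {b : Q → ℝ} (hb : ∀ q, 0 ≤ b q) (σ : Strategy A O) :
    0 ≤ P.reachFrom G b σ :=
  Finset.sum_nonneg fun q _ => mul_nonneg (hb q) (P.reachProb_nonneg _ _ _)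

theorem reachFrom_le_mass (G : Set Q) {b : Q → ℝ} (hb : ∀ q, 0 ≤ b q) (σ : Strategy A O) :
    P.reachFrom G b σ ≤ mass b :=
  Finset.sum_le_sum fun q _ => mul_le_of_le_one_right (hb q) (P.reachProb_le_one _ _ _)

theorem val_eq (G : Set Q) {b : Q → ℝ} (hb : ∀ q, 0 ≤ b q) :
    P.val G b = ⨆ σ, P.reachFrom G b σ := by
  simp only [val, reachFrom, P.runMeasure_reach G b hb]

theorem bddAbove_reachFrom (G : Set Q) {b : Q → ℝ} (hb : ∀ q, 0 ≤ b q) :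
    BddAbove (Set.range fun σ => P.reachFrom G b σ) :=
  ⟨mass b, by rintro _ ⟨σ, rfl⟩; exact P.reachFrom_le_mass G hb σ⟩

theorem reachFrom_le_val (G : Set Q) {b : Q → ℝ} (hb : ∀ q, 0 ≤ b q) (σ : Strategy A O) :
    P.reachFrom G b σ ≤ P.val G b := by
  rw [P.val_eq G hb]
  exact le_ciSup (P.bddAbove_reachFrom G hb) σ

theorem val_nonneg (G : Set Q) {b : Q → ℝ} (hb : ∀ q, 0 ≤ b q) : 0 ≤ P.val G b := by
  rw [P.val_eq G hb]
  exact Real.iSup_nonneg fun σ => P.reachFrom_nonneg G hb σ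

/-- Homogeneity allows passing between the normalized beliefs of the tree and the unnormalized ones,
on which transitions act linearly. -/
theorem val_smul (G : Set Q) {c : ℝ} (hc : 0 ≤ c) {b : Q → ℝ} (hb : ∀ q, 0 ≤ b q) :
    P.val G (c • b) = c * P.val G b := by
  rw [P.val_eq G hb, P.val_eq G (smul_nonneg_apply hc hb), Real.mul_iSup_of_nonneg hc]
  simp only [reachFrom_smul]

variable [Nonempty A]

theorem val_le (G : Set Q) {b : Q → ℝ} (hb : ∀ q, 0 ≤ b q) {B : ℝ}
    (h : ∀ σ, P.reachFrom G b σ ≤ B) : P.val G b ≤ B := by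
  rw [P.val_eq G hb]
  exact ciSup_le h

theorem val_le_mass (G : Set Q) {b : Q → ℝ} (hb : ∀ q, 0 ≤ b q) : P.val G b ≤ mass b :=
  P.val_le G hb (P.reachFrom_le_mass G hb)

theorem val_zero (G : Set Q) : P.val G 0 = 0 := by
  have := P.val_smul G le_rfl (b := 0) (fun _ => le_rfl)
  simpa using this

theorem exists_lt_reachFrom (G : Set Q) {b : Q → ℝ} (hb : ∀ q, 0 ≤ b q) {B : ℝ}
    (h : B < P.val G b) : ∃ σ, B < P.reachFrom G b σ := by
  rw [P.val_eq G hb] at h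
  exact exists_lt_of_lt_ciSup h

/-- A strategy for the mixture has to be used on all components at once, whereas on the right each
component gets its own. -/
theorem val_sum_le (G : Set Q) {ι : Type*} (s : Finset ι) {b : ι → Q → ℝ}
    (hb : ∀ i ∈ s, ∀ q, 0 ≤ b i q) : P.val G (∑ i ∈ s, b i) ≤ ∑ i ∈ s, P.val G (b i) := by
  refine P.val_le G (sum_nonneg_apply hb) fun σ => ?_
  rw [reachFrom_sum]
  exact Finset.sum_le_sum fun i hi => P.reachFrom_le_val G (hb i hi) σ

theorem val_mono (G : Set Q) {b c : Q → ℝ} (hb : ∀ q, 0 ≤ b q) (hbc : ∀ q, b q ≤ c q) :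
    P.val G b ≤ P.val G c := by
  refine P.val_le G hb fun σ => le_trans ?_
    (P.reachFrom_le_val G (fun q => (hb q).trans (hbc q)) σ)
  exact Finset.sum_le_sum fun q _ => mul_le_mul_of_nonneg_right (hbc q) (P.reachProb_nonneg _ _ _)

theorem val_le_val_add_mass (G : Set Q) {b c : Q → ℝ} (hc : ∀ q, 0 ≤ c q) (hcb : ∀ q, c q ≤ b q) :
    P.val G b ≤ P.val G c + ∑ q, (b q - c q) := by
  refine P.val_le G (fun q => (hc q).trans (hcb q)) fun σ => ?_
  refine le_trans ?_ (add_le_add_left (P.reachFrom_le_val G hc σ) _)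
  rw [reachFrom, reachFrom, ← Finset.sum_add_distrib]
  refine Finset.sum_le_sum fun q _ => ?_
  have := mul_le_of_le_one_right (sub_nonneg.2 (hcb q)) (P.reachProb_le_one G σ q)
  linarith [sub_mul (b q) (c q) (P.reachProb G σ q)]

theorem valAct_eq (G : Set Q) {b : Q → ℝ} (hb : ∀ q, 0 ≤ b q) (a : A) :
    P.valAct G b a = ∑ o, P.val G (P.push b a o) := by
  refine Finset.sum_congr rfl fun o _ => ?_
  rw [← P.obsProb_smul_update hb, P.val_smul G (P.obsProb_nonneg hb a o) (P.update_nonneg hb a o)]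

/-! ### Bellman inequalities -/

theorem sum_mul_sum_T (b v : Q → ℝ) (a : A) (o : O) :
    ∑ q, b q * ∑ q', P.T q a o q' * v q' = ∑ q', P.push b a o q' * v q' := by
  simp only [push, Finset.mul_sum, Finset.sum_mul, mul_assoc]
  exact Finset.sum_comm

theorem sum_mul_act (b : Q → ℝ) (p : A → ℝ) (v : A → O → Q → ℝ) :
    ∑ q, b q * ∑ a, p a * ∑ o, ∑ q', P.T q a o q' * v a o q' =
      ∑ a, p a * ∑ o, ∑ q', P.push b a o q' * v a o q' := by
  simp only [← sum_mul_sum_T, Finset.mul_sum]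
  rw [Finset.sum_comm]
  refine Finset.sum_congr rfl fun a _ => ?_
  rw [Finset.sum_comm]
  refine Finset.sum_congr rfl fun o _ => Finset.sum_congr rfl fun q _ =>
    Finset.sum_congr rfl fun q' _ => ?_
  ring

theorem reachFrom_eq {top : Q} (htop : P.Absorbing top) (b : Q → ℝ) (σ : Strategy A O) :
    P.reachFrom {top} b σ =
      ∑ a, σ.prob [] a * ∑ o, P.reachFrom {top} (P.push b a o) (σ.shift a o) := by
  refine Eq.trans ?_ (P.sum_mul_act b _ fun a o q' => P.reachProb {top} (σ.shift a o) q')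
  exact Finset.sum_congr rfl fun q _ => by rw [P.reachProb_eq htop]

theorem sum_val_push_le {top : Q} (htop : P.Absorbing top) {b : Q → ℝ} (hb : ∀ q, 0 ≤ b q)
    (a : A) : ∑ o, P.val {top} (P.push b a o) ≤ P.val {top} b := by
  classical
  refine le_of_forall_pos_le_add fun ε hε => ?_
  -- The loss `δ` is incurred once per observation; the `+ 1` avoids a division by zero.
  set δ : ℝ := ε / (Fintype.card O + 1) with hδ
  have hδ0 : 0 < δ := by positivity
  choose τ hτ using fun o => P.exists_lt_reachFrom {top} (P.push_nonneg hb a o)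
    (sub_lt_self (P.val {top} (P.push b a o)) hδ0)
  -- Play `a`, then follow the nearly optimal strategy attached to the first observation. The
  -- recorded first action is ignored.
  let σ : Strategy A O :=
    { prob := fun h a' => match h with
        | [] => if a' = a then 1 else 0
        | x :: h => (τ x.2).prob h a'
      prob_nonneg := fun h a' => by
        cases h with
        | nil => dsimp only; positivity
        | cons x h => exact (τ x.2).prob_nonneg _ _
      prob_sum := fun h => by
        cases h with
        | nil => simp
        | cons x h => exact (τ x.2).prob_sum _ }
  have hσ : ∀ o, σ.shift a o = τ o := fun o => rfl
  have h1 := P.reachFrom_le_val {top} hb σ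
  rw [P.reachFrom_eq htop, Finset.sum_eq_single a] at h1
  · have h2 : ∑ o, (P.val {top} (P.push b a o) - δ) ≤
        ∑ o, P.reachFrom {top} (P.push b a o) (τ o) :=
      Finset.sum_le_sum fun o _ => (hτ o).le
    have h3 : σ.prob [] a = 1 := by simp [σ]
    simp only [h3, one_mul, hσ] at h1
    rw [Finset.sum_sub_distrib, Finset.sum_const, nsmul_eq_mul, Finset.card_univ] at h2
    have h4 : (Fintype.card O : ℝ) * δ ≤ ε := by
      rw [hδ, mul_div_assoc', div_le_iff₀ (by positivity)]
      nlinarith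
    linarith
  · intro a' _ ha'
    simp [σ, ha']
  · simp

theorem valAct_le_val {top : Q} (htop : P.Absorbing top) {b : Q → ℝ} (hb : ∀ q, 0 ≤ b q)
    (a : A) : P.valAct {top} b a ≤ P.val {top} b := by
  rw [P.valAct_eq _ hb]
  exact P.sum_val_push_le htop hb a

theorem val_le_of_valAct_le {top : Q} (htop : P.Absorbing top) {b : Q → ℝ} (hb : ∀ q, 0 ≤ b q)
    {B : ℝ} (h : ∀ a, P.valAct {top} b a ≤ B) : P.val {top} b ≤ B := by
  refine P.val_le _ hb fun σ => ?_
  rw [P.reachFrom_eq htop, ← one_mul B, ← σ.prob_sum [], Finset.sum_mul]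
  refine Finset.sum_le_sum fun a _ => mul_le_mul_of_nonneg_left ?_ (σ.prob_nonneg _ _)
  refine le_trans ?_ (h a)
  rw [P.valAct_eq _ hb]
  exact Finset.sum_le_sum fun o _ => P.reachFrom_le_val _ (P.push_nonneg hb a o) _

/-- If every action allowed by `f` keeps the process in a set `X` of unnormalized beliefs of mass
proportional to their normalization, all of which avoid the target, and if the other actions have
value at most `B`, then `B` bounds the value on `X`. -/
theorem val_le_of_stay {top : Q} (htop : P.Absorbing top) (X : Set (Q → ℝ)) {m B : ℝ}
    (hm : 0 < m) (hB : 0 ≤ B) (hX : ∀ c ∈ X, (∀ q, 0 ≤ c q) ∧ mass c = m ∧ c top = 0)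
    (stay : ∀ c ∈ X, ∀ a, P.valAct {top} c a ≤ B ∨
      ∀ o, 0 < P.obsProb c a o → m • P.update c a o ∈ X)
    {b : Q → ℝ} (hbX : b ∈ X) : P.val {top} b ≤ B := by
  -- The bound is proved at finite horizons. Bellman's equation for the limit value would not bound
  -- the plays that stay in `X` forever; at horizon `0` they contribute nothing because `X` avoids
  -- `top`.
  have key : ∀ n, ∀ c ∈ X, ∀ σ, ∑ q, c q * P.reachWithin {top} n σ q ≤ B := by
    intro n
    induction n with
    | zero =>
      intro c hc σ
      rw [Finset.sum_eq_zero]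
      · exact hB
      · intro q _
        by_cases hq : q = top
        · rw [hq, (hX c hc).2.2, zero_mul]
        · rw [P.reachWithin_zero_of_notMem _ _ (by simpa using hq), mul_zero]
    | succ n ih =>
      intro c hc σ
      obtain ⟨hc0, hcm, -⟩ := hX c hc
      simp only [P.reachWithin_succ htop]
      rw [sum_mul_act P c _ fun a o q' => P.reachWithin {top} n (σ.shift a o) q',
        ← one_mul B, ← σ.prob_sum [], Finset.sum_mul]
      refine Finset.sum_le_sum fun a _ => mul_le_mul_of_nonneg_left ?_ (σ.prob_nonneg _ _)
      rcases stay c hc a with h | h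
      · refine le_trans ?_ h
        rw [P.valAct_eq _ hc0]
        refine Finset.sum_le_sum fun o _ => le_trans ?_
          (P.reachFrom_le_val _ (P.push_nonneg hc0 a o) (σ.shift a o))
        exact Finset.sum_le_sum fun q _ => mul_le_mul_of_nonneg_left
          (P.reachWithin_le_reachProb _ _ _ _) (P.push_nonneg hc0 a o q)
      · have h1 : ∀ o, ∑ q', P.push c a o q' * P.reachWithin {top} n (σ.shift a o) q' ≤
            P.obsProb c a o / m * B := by
          intro o
          rcases (P.obsProb_nonneg hc0 a o).eq_or_lt with h0 | h0
          · have : P.push c a o = 0 := eq_zero_of_mass_eq_zero (P.push_nonneg hc0 a o)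
              (by rw [mass_push, ← h0])
            simp [this, ← h0]
          · have h2 := ih _ (h o h0) (σ.shift a o)
            have h3 : P.push c a o = (P.obsProb c a o / m) • m • P.update c a o := by
              rw [smul_smul, div_mul_cancel₀ _ hm.ne', P.obsProb_smul_update hc0]
            rw [h3]
            simp only [Pi.smul_apply, smul_eq_mul, mul_assoc]
            rw [← Finset.mul_sum]
            refine mul_le_mul_of_nonneg_left ?_ (by positivity)
            simpa [mul_assoc] using h2
        refine (Finset.sum_le_sum fun o _ => h1 o).trans ?_
        rw [← Finset.sum_mul, ← Finset.sum_div, sum_obsProb, hcm, div_self hm.ne', one_mul]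
  refine P.val_le _ (hX b hbX).1 fun σ => ?_
  refine le_of_tendsto' (tendsto_finsetSum Finset.univ fun q _ =>
    (P.tendsto_reachWithin {top} σ q).const_mul (b q)) fun n => ?_
  exact key n b hbX σ

end POMDP

namespace POMDP

variable {Q A O : Type u} [Fintype Q] [Fintype A] [Fintype O] (P : POMDP Q A O)

/-! ### Posterior-determinism -/

open Classical in
/-- The successor of the state `q` under `a` and `o`, if there is one. -/
noncomputable def succ (q : Q) (a : A) (o : O) : Q :=
  if h : ∃ q', 0 < P.T q a o q' then h.choose else q

/-- The state reached from `q` along an observable history. -/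
noncomputable def track (h : List (A × O)) (q : Q) : Q := h.foldl (fun r x => P.succ r x.1 x.2) q

@[simp] theorem track_nil (q : Q) : P.track [] q = q := rfl

theorem track_cons (x : A × O) (h : List (A × O)) (q : Q) :
    P.track (x :: h) q = P.track h (P.succ q x.1 x.2) := rfl

theorem track_append (h g : List (A × O)) (q : Q) :
    P.track (h ++ g) q = P.track g (P.track h q) := by
  simp [track, List.foldl_append]

theorem deltaStar_append (S : Finset Q) (h g : List (A × O)) :
    P.deltaStar S (h ++ g) = P.deltaStar (P.deltaStar S h) g := by
  simp [deltaStar, List.foldl_append]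

theorem deltaStar_cons (S : Finset Q) (x : A × O) (h : List (A × O)) :
    P.deltaStar S (x :: h) = P.deltaStar (P.delta S x.1 x.2) h := rfl

@[simp] theorem deltaStar_nil (S : Finset Q) : P.deltaStar S ([] : List (A × O)) = S := rfl

theorem mem_delta {S : Finset Q} {a : A} {o : O} {q' : Q} :
    q' ∈ P.delta S a o ↔ ∃ q ∈ S, 0 < P.T q a o q' := by
  simp [delta]

variable {P}

theorem PosteriorDeterministic.eq_succ (hP : P.PosteriorDeterministic) {q q' : Q} {a : A} {o : O}
    (h : 0 < P.T q a o q') : q' = P.succ q a o := by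
  have h' : ∃ q', 0 < P.T q a o q' := ⟨q', h⟩
  rw [succ, dif_pos h']
  exact hP _ _ _ _ _ h h'.choose_spec

theorem PosteriorDeterministic.T_of_ne (hP : P.PosteriorDeterministic) {q q' : Q} {a : A} {o : O}
    (h : q' ≠ P.succ q a o) : P.T q a o q' = 0 :=
  ((P.T_nonneg _ _ _ _).eq_or_lt.resolve_right fun h' => h (hP.eq_succ h')).symm

/-- This holds also where there is no successor: both sides are then `0`, so the default value of
`succ` is harmless. -/
theorem PosteriorDeterministic.T_succ (hP : P.PosteriorDeterministic) (q : Q) (a : A) (o : O) :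
    P.T q a o (P.succ q a o) = P.stateObsProb q a o :=
  (Finset.sum_eq_single _ (fun _ _ h => hP.T_of_ne h) (by simp)).symm

theorem PosteriorDeterministic.T_eq (hP : P.PosteriorDeterministic) (q : Q) (a : A) (o : O) :
    P.T q a o = P.stateObsProb q a o • dirac (P.succ q a o) := by
  ext q'
  by_cases h : q' = P.succ q a o
  · simp [h, dirac, hP.T_succ]
  · simp [h, dirac, hP.T_of_ne h]

theorem PosteriorDeterministic.mem_delta_iff (hP : P.PosteriorDeterministic) {S : Finset Q} {a : A}
    {o : O} {q' : Q} :
    q' ∈ P.delta S a o ↔ ∃ q ∈ S, 0 < P.stateObsProb q a o ∧ P.succ q a o = q' := by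
  rw [mem_delta]
  refine exists_congr fun q => and_congr_right fun _ => ⟨fun h => ?_, ?_⟩
  · obtain rfl := hP.eq_succ h
    exact ⟨hP.T_succ q a o ▸ h, rfl⟩
  · rintro ⟨h, rfl⟩
    rwa [hP.T_succ]

open Classical in
theorem PosteriorDeterministic.delta_eq_image (hP : P.PosteriorDeterministic) (S : Finset Q) (a : A)
    (o : O) : P.delta S a o =
      (S.filter fun q => 0 < P.stateObsProb q a o).image fun q => P.succ q a o := by
  ext q'
  simp [hP.mem_delta_iff, and_assoc]

/-- The new support is the image of a subset of the old one. This is the main use of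
posterior-determinism. -/
theorem PosteriorDeterministic.card_delta_le (hP : P.PosteriorDeterministic) (S : Finset Q) (a : A)
    (o : O) : (P.delta S a o).card ≤ S.card := by
  classical
  rw [hP.delta_eq_image]
  exact Finset.card_image_le.trans (Finset.card_filter_le _ _)

theorem PosteriorDeterministic.card_deltaStar_le (hP : P.PosteriorDeterministic) (S : Finset Q)
    (h : List (A × O)) : (P.deltaStar S h).card ≤ S.card := by
  induction h generalizing S with
  | nil => exact le_rfl
  | cons x h ih => exact (ih _).trans (hP.card_delta_le _ _ _)

/-! ### Histories inside a support end component -/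

theorem inside_append {f : ActionMap Q A} {S : Finset Q} {h g : List (A × O)} :
    P.Inside f S (h ++ g) ↔ P.Inside f S h ∧ P.Inside f (P.deltaStar S h) g := by
  induction h generalizing S with
  | nil => simp [Inside]
  | cons x h ih => simp [Inside, ih, deltaStar_cons, and_assoc]

theorem inside_snoc {f : ActionMap Q A} {S : Finset Q} {h : List (A × O)} {x : A × O} :
    P.Inside f S (h ++ [x]) ↔ P.Inside f S h ∧ x.1 ∈ f (P.deltaStar S h) ∧
      (P.delta (P.deltaStar S h) x.1 x.2).Nonempty := by
  simp [inside_append, Inside]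

variable {f : ActionMap Q A} {S : Finset Q}

theorem IsSEC.deltaStar_mem_dom (hf : P.IsSEC f) (hS : S ∈ dom f) {h : List (A × O)}
    (hh : P.Inside f S h) : P.deltaStar S h ∈ dom f := by
  induction h generalizing S with
  | nil => exact hS
  | cons x h ih => exact ih (hf.closed S hS _ hh.1 _ hh.2.1) hh.2.2

/-- Sizes cannot grow along a history, and any two supports of the component reach each other. -/
theorem IsSEC.card_eq (hf : P.IsSEC f) (hP : P.PosteriorDeterministic) (hS : S ∈ dom f)
    {T : Finset Q} (hT : T ∈ dom f) : S.card = T.card := by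
  obtain ⟨h, -, rfl⟩ := hf.connected S hS T hT
  obtain ⟨g, -, hg⟩ := hf.connected _ hT S hS
  refine le_antisymm ?_ (hP.card_deltaStar_le _ _)
  conv_lhs => rw [← hg]
  exact hP.card_deltaStar_le _ _

/-- Inside a support end component every state of the support admits every possible observation,
and the successors are distinct. -/
theorem IsSEC.stateObsProb_pos (hf : P.IsSEC f) (hP : P.PosteriorDeterministic) (hS : S ∈ dom f)
    {a : A} (ha : a ∈ f S) {o : O} (ho : (P.delta S a o).Nonempty) {q : Q} (hq : q ∈ S) :
    0 < P.stateObsProb q a o := by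
  classical
  have h1 := hf.card_eq hP hS (hf.closed S hS a ha o ho)
  rw [hP.delta_eq_image] at h1
  -- The image of the filtered set has as many elements as `S`, so the filter discards nothing.
  have h2 : S.filter (fun q => 0 < P.stateObsProb q a o) = S :=
    Finset.eq_of_subset_of_card_le (Finset.filter_subset _ _) (h1.le.trans Finset.card_image_le)
  rw [← h2, Finset.mem_filter] at hq
  exact hq.2

open Classical in
theorem IsSEC.delta_eq (hf : P.IsSEC f) (hP : P.PosteriorDeterministic) (hS : S ∈ dom f)
    {a : A} (ha : a ∈ f S) {o : O} (ho : (P.delta S a o).Nonempty) :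
    P.delta S a o = S.image fun q => P.succ q a o := by
  rw [hP.delta_eq_image, Finset.filter_true_of_mem]
  exact fun q hq => hf.stateObsProb_pos hP hS ha ho hq

open Classical in
theorem IsSEC.deltaStar_eq (hf : P.IsSEC f) (hP : P.PosteriorDeterministic) (hS : S ∈ dom f)
    {h : List (A × O)} (hh : P.Inside f S h) : P.deltaStar S h = S.image (P.track h) := by
  induction h generalizing S with
  | nil => ext; simp
  | cons x h ih =>
    rw [deltaStar_cons, ih (hf.closed S hS _ hh.1 _ hh.2.1) hh.2.2,
      hf.delta_eq hP hS hh.1 hh.2.1, Finset.image_image]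
    rfl

theorem IsSEC.track_mem (hf : P.IsSEC f) (hP : P.PosteriorDeterministic) (hS : S ∈ dom f)
    {h : List (A × O)} (hh : P.Inside f S h) {q : Q} (hq : q ∈ S) :
    P.track h q ∈ P.deltaStar S h := by
  classical
  rw [hf.deltaStar_eq hP hS hh]
  exact Finset.mem_image_of_mem _ hq

/-- The map is onto a support of the same size. -/
theorem IsSEC.injOn_track (hf : P.IsSEC f) (hP : P.PosteriorDeterministic) (hS : S ∈ dom f)
    {h : List (A × O)} (hh : P.Inside f S h) : Set.InjOn (P.track h) S := by
  classical
  rw [← Finset.card_image_iff, ← hf.deltaStar_eq hP hS hh]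
  exact (hf.card_eq hP hS (hf.deltaStar_mem_dom hS hh)).symm

theorem IsSEC.deltaStar_singleton (hf : P.IsSEC f) (hP : P.PosteriorDeterministic) (hS : S ∈ dom f)
    {h : List (A × O)} (hh : P.Inside f S h) {q : Q} (hq : q ∈ S) :
    P.deltaStar {q} h = {P.track h q} := by
  classical
  induction h generalizing S q with
  | nil => rfl
  | cons x h ih =>
    have h1 : P.delta {q} x.1 x.2 = {P.succ q x.1 x.2} := by
      rw [hP.delta_eq_image, Finset.filter_true_of_mem, Finset.image_singleton]
      intro r hr
      rw [Finset.mem_singleton.1 hr]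
      exact hf.stateObsProb_pos hP hS hh.1 hh.2.1 hq
    rw [deltaStar_cons, h1, ih (hf.closed S hS _ hh.1 _ hh.2.1) hh.2.2, track_cons]
    rw [hf.delta_eq hP hS hh.1 hh.2.1]
    exact Finset.mem_image_of_mem _ hq

theorem IsSEC.indist_iff (hf : P.IsSEC f) (hP : P.PosteriorDeterministic) (hS : S ∈ dom f)
    {q q' : Q} (hq : q ∈ S) (hq' : q' ∈ S) :
    P.Indist f S q q' ↔ ∀ h, P.Inside f S h → ∀ a ∈ f (P.deltaStar S h), ∀ o,
      P.stateObsProb (P.track h q) a o = P.stateObsProb (P.track h q') a o := by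
  refine forall_congr' fun h => forall_congr' fun hh => ?_
  simp [hf.deltaStar_singleton hP hS hh hq, hf.deltaStar_singleton hP hS hh hq']

/-- A loop can be iterated until it acts as the identity. -/
theorem IsSEC.exists_loop_inverse (hf : P.IsSEC f) (hP : P.PosteriorDeterministic) (hS : S ∈ dom f)
    {h : List (A × O)} (hh : P.Inside f S h) (hloop : P.deltaStar S h = S) :
    ∃ g, P.Inside f S g ∧ P.deltaStar S g = S ∧ ∀ q ∈ S, P.track g (P.track h q) = q := by
  classical
  let e : S → S := fun q => ⟨P.track h q, by
    have := hf.track_mem hP hS hh q.2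
    rwa [hloop] at this⟩
  have he : Function.Injective e := fun q q' hqq =>
    Subtype.ext (hf.injOn_track hP hS hh q.2 q'.2 (congrArg Subtype.val hqq))
  let π : Equiv.Perm S := Equiv.ofBijective e (Finite.injective_iff_bijective.1 he)
  have key : ∀ n : ℕ, ∃ g, P.Inside f S g ∧ P.deltaStar S g = S ∧
      ∀ q : S, P.track g q = (π ^ n) q := by
    intro n
    induction n with
    | zero => exact ⟨[], trivial, rfl, fun q => rfl⟩
    | succ n ih =>
      obtain ⟨g, h1, h2, h3⟩ := ih
      refine ⟨g ++ h, inside_append.2 ⟨h1, by rwa [h2]⟩, by rw [deltaStar_append, h2, hloop], ?_⟩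
      intro q
      rw [track_append, h3, pow_succ', Equiv.Perm.mul_apply]
      rfl
  -- The loop permutes the finite set `S`, so its power `orderOf π - 1` is its inverse.
  obtain ⟨g, h1, h2, h3⟩ := key (orderOf π - 1)
  refine ⟨g, h1, h2, fun q hq => ?_⟩
  have h4 := h3 (π ⟨q, hq⟩)
  rw [← Equiv.Perm.mul_apply, ← pow_succ, Nat.sub_add_cancel (orderOf_pos π), pow_orderOf_eq_one]
    at h4
  exact h4

/-- Every history inside a support end component extends to one that acts as the identity. -/
theorem IsSEC.exists_return (hf : P.IsSEC f) (hP : P.PosteriorDeterministic) (hS : S ∈ dom f)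
    {h : List (A × O)} (hh : P.Inside f S h) :
    ∃ g, P.Inside f S (h ++ g) ∧ P.deltaStar S (h ++ g) = S ∧
      ∀ q ∈ S, P.track (h ++ g) q = q := by
  obtain ⟨g₁, h1, h2⟩ := hf.connected _ (hf.deltaStar_mem_dom hS hh) S hS
  have h3 : P.Inside f S (h ++ g₁) := inside_append.2 ⟨hh, h1⟩
  have h4 : P.deltaStar S (h ++ g₁) = S := by rw [deltaStar_append, h2]
  obtain ⟨g₂, h5, h6, h7⟩ := hf.exists_loop_inverse hP hS h3 h4
  refine ⟨g₁ ++ g₂, ?_, ?_, fun q hq => ?_⟩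
  · rw [← List.append_assoc, inside_append, h4]
    exact ⟨h3, h5⟩
  · rw [← List.append_assoc, deltaStar_append, h4, h6]
  · rw [← List.append_assoc, track_append, h7 q hq]

/-! ### Beliefs transported inside a support end component -/

/-- The image of the restriction of the weights `w` to `C` under `x`. -/
noncomputable def transport (C : Finset Q) (w : Q → ℝ) (x : Q → Q) : Q → ℝ :=
  ∑ q ∈ C, w q • dirac (x q)

theorem dirac_nonneg (q r : Q) : 0 ≤ dirac q r := by
  unfold dirac; positivity

theorem mass_dirac (q : Q) : mass (dirac q) = 1 := by
  classical
  simp [mass, dirac]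

theorem transport_nonneg {C : Finset Q} {w : Q → ℝ} (hw : ∀ q, 0 ≤ w q) (x : Q → Q) (r : Q) :
    0 ≤ transport C w x r :=
  sum_nonneg_apply (fun q _ => smul_nonneg_apply (hw q) (dirac_nonneg (x q))) r

theorem mass_transport (C : Finset Q) (w : Q → ℝ) (x : Q → Q) :
    mass (transport C w x) = ∑ q ∈ C, w q := by
  simp [transport, mass_sum, mass_smul, mass_dirac]

theorem transport_congr {C : Finset Q} {w : Q → ℝ} {x y : Q → Q} (h : ∀ q ∈ C, x q = y q) :
    transport C w x = transport C w y :=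
  Finset.sum_congr rfl fun q hq => by rw [h q hq]

theorem transport_id (C : Finset Q) (w : Q → ℝ) {x : Q → Q} (hx : ∀ q ∈ C, x q = q) :
    transport C w x = restrict w C := by
  classical
  ext r
  rw [transport_congr hx]
  simp [transport, restrict, dirac]

theorem supp_transport {C : Finset Q} {w : Q → ℝ} (hw : ∀ q, 0 ≤ w q) (hC : ∀ q ∈ C, 0 < w q)
    (x : Q → Q) (r : Q) : r ∈ supp (transport C w x) ↔ ∃ q ∈ C, x q = r := by
  classical
  simp only [supp, Finset.mem_filter, Finset.mem_univ, true_and, transport, Finset.sum_apply,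
    Pi.smul_apply, smul_eq_mul]
  rw [Finset.sum_pos_iff_of_nonneg fun q _ => mul_nonneg (hw q) (dirac_nonneg _ _)]
  refine exists_congr fun q => and_congr_right fun hq => ?_
  rw [mul_pos_iff_of_pos_left (hC q hq), dirac]
  split_ifs with h
  · simp [h]
  · simp [Ne.symm h]

theorem push_smul (c : ℝ) (b : Q → ℝ) (a : A) (o : O) :
    P.push (c • b) a o = c • P.push b a o := by
  ext q
  simp [push, Finset.mul_sum, mul_assoc]

theorem push_sum {ι : Type*} (s : Finset ι) (b : ι → Q → ℝ) (a : A) (o : O) :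
    P.push (∑ i ∈ s, b i) a o = ∑ i ∈ s, P.push (b i) a o := by
  ext q
  simp only [push, Finset.sum_apply, Finset.sum_mul]
  exact Finset.sum_comm

theorem PosteriorDeterministic.push_dirac (hP : P.PosteriorDeterministic) (q : Q) (a : A) (o : O) :
    P.push (dirac q) a o = P.stateObsProb q a o • dirac (P.succ q a o) := by
  rw [← hP.T_eq]
  classical
  ext r
  simp [push, dirac]

/-- When all tracked states emit `o` with the same probability, conditioning on `o` moves the points
but leaves their relative weights unchanged. -/
theorem PosteriorDeterministic.push_transport (hP : P.PosteriorDeterministic) (C : Finset Q)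
    (w : Q → ℝ) (x : Q → Q) (a : A) (o : O) {p : ℝ} (hp : ∀ q ∈ C, P.stateObsProb (x q) a o = p) :
    P.push (transport C w x) a o = p • transport C w (fun q => P.succ (x q) a o) := by
  rw [transport, push_sum, transport, Finset.smul_sum]
  refine Finset.sum_congr rfl fun q hq => ?_
  rw [push_smul, hP.push_dirac, hp q hq, smul_comm]

end POMDP

/-! ### Constancy of the value on indistinguishable states of a support end component -/

namespace POMDP

variable {Q A O : Type u} [Fintype Q] [Fintype A] [Fintype O] {P : POMDP Q A O}
variable {f : ActionMap Q A} {S : Finset Q}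

theorem track_snoc (h : List (A × O)) (a : A) (o : O) (q : Q) :
    P.track (h ++ [(a, o)]) q = P.succ (P.track h q) a o := by
  rw [track_append]; rfl

/-- On a set of indistinguishable states, the common probability of observing `o`. -/
theorem IsSEC.exists_common_obsProb (hf : P.IsSEC f) (hP : P.PosteriorDeterministic)
    (hS : S ∈ dom f) {C : Finset Q} (hC : C.Nonempty) (hCS : C ⊆ S)
    (hCi : ∀ q ∈ C, ∀ q' ∈ C, P.Indist f S q q') {h : List (A × O)} (hh : P.Inside f S h) {a : A}
    (ha : a ∈ f (P.deltaStar S h)) :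
    ∃ p : O → ℝ, (∀ o, 0 ≤ p o) ∧ ∑ o, p o = 1 ∧
      (∀ o, 0 < p o ↔ P.Inside f S (h ++ [(a, o)])) ∧
      ∀ o, ∀ q ∈ C, P.stateObsProb (P.track h q) a o = p o := by
  obtain ⟨q₀, hq₀⟩ := hC
  refine ⟨fun o => P.stateObsProb (P.track h q₀) a o, fun o => P.stateObsProb_nonneg _ _ _,
    P.sum_stateObsProb _ _, fun o => ?_, fun o q hq => ?_⟩
  · have h1 := hf.track_mem hP hS hh (hCS hq₀)
    have h2 := hf.deltaStar_mem_dom hS hh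
    rw [inside_snoc]
    constructor
    · exact fun hp => ⟨hh, ha, _, hP.mem_delta_iff.2 ⟨_, h1, hp, rfl⟩⟩
    · exact fun hp => hf.stateObsProb_pos hP h2 ha hp.2.2 h1
  · exact (hf.indist_iff hP hS (hCS hq) (hCS hq₀)).1 (hCi q hq q₀ hq₀) h hh a ha o

theorem PosteriorDeterministic.push_transport_track (hP : P.PosteriorDeterministic) {C : Finset Q}
    (w : Q → ℝ) {h : List (A × O)} {a : A} {o : O} {p : ℝ}
    (hp : ∀ q ∈ C, P.stateObsProb (P.track h q) a o = p) :
    P.push (transport C w (P.track h)) a o = p • transport C w (P.track (h ++ [(a, o)])) := by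
  rw [hP.push_transport C w _ a o hp]
  simp only [← track_snoc]

variable [Nonempty A]

/-- The value is constant along the histories inside a support end component, for a belief whose
states are pairwise indistinguishable. -/
theorem IsSEC.val_transport_eq (hf : P.IsSEC f) (hP : P.PosteriorDeterministic)
    {top : Q} (htop : P.Absorbing top) (hS : S ∈ dom f) {C : Finset Q} (hCS : C ⊆ S)
    (hCi : ∀ q ∈ C, ∀ q' ∈ C, P.Indist f S q q') {w : Q → ℝ} (hw : ∀ q, 0 ≤ w q)
    {h : List (A × O)} (hh : P.Inside f S h) :
    P.val {top} (transport C w (P.track h)) = P.val {top} (transport C w id) := by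
  classical
  rcases C.eq_empty_or_nonempty with rfl | hC
  · simp [transport]
  set g : (Q → Q) → ℝ := fun x => P.val {top} (transport C w x) with hg
  -- Histories are infinitely many, but they induce only finitely many maps of `Q`, so the least
  -- value is attained.
  have hfin : (g '' {x | ∃ h, P.Inside f S h ∧ P.track h = x}).Finite := Set.toFinite _
  obtain ⟨m, ⟨_, ⟨h₀, hh₀, rfl⟩, rfl⟩, hmin⟩ := hfin.exists_minimal
    ⟨_, _, ⟨[], trivial, rfl⟩, rfl⟩
  have hle : ∀ h, P.Inside f S h → g (P.track h₀) ≤ g (P.track h) := by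
    intro h hh
    by_contra hlt
    exact hlt (hmin ⟨_, ⟨h, hh, rfl⟩, rfl⟩ (not_le.1 hlt).le)
  -- Minimum principle: at a history of least value, the average of the values after any allowed
  -- action is at most the minimum, while each possible outcome is at least the minimum. Hence all
  -- are equal to it.
  have hstep : ∀ h, P.Inside f S (h₀ ++ h) → g (P.track (h₀ ++ h)) = g (P.track h₀) := by
    intro h
    induction h using List.reverseRecOn with
    | nil => intro _; rw [List.append_nil]
    | append_singleton h x ih =>
      obtain ⟨a, o⟩ := x
      intro hin
      rw [← List.append_assoc] at hin ⊢
      have hin' := inside_snoc.1 hin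
      obtain ⟨p, hp0, hp1, hppos, hp⟩ := hf.exists_common_obsProb hP hS hC hCS hCi hin'.1 hin'.2.1
      have h1 := P.sum_val_push_le htop
        (transport_nonneg (C := C) hw (P.track (h₀ ++ h))) a
      have h2 : ∀ o', P.val {top} (P.push (transport C w (P.track (h₀ ++ h))) a o') =
          p o' * g (P.track (h₀ ++ h ++ [(a, o')])) := by
        intro o'
        rw [hP.push_transport_track w (hp o'), P.val_smul _ (hp0 o') (transport_nonneg hw _)]
      have h3 : ∀ o', p o' * g (P.track h₀) ≤ p o' * g (P.track (h₀ ++ h ++ [(a, o')])) := by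
        intro o'
        rcases (hp0 o').eq_or_lt with h0 | h0
        · simp [← h0]
        · exact mul_le_mul_of_nonneg_left (hle _ ((hppos o').1 h0)) (hp0 o')
      have h4 : ∑ o', p o' * g (P.track (h₀ ++ h ++ [(a, o')])) ≤ ∑ o', p o' * g (P.track h₀) := by
        rw [← Finset.sum_mul, hp1, one_mul]
        simp only [h2] at h1
        exact h1.trans (ih hin'.1).le
      have h5 := (Finset.sum_eq_sum_iff_of_le fun o' _ => h3 o').1
        (le_antisymm (Finset.sum_le_sum fun o' _ => h3 o') h4) o (Finset.mem_univ o)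
      exact (mul_left_cancel₀ ((hppos o).2 hin).ne' h5).symm
  -- From the minimizing history one can return by a history `r` such that `h₀ ++ r` acts as the
  -- identity on `S`; appending `h` then reproduces the effect of any `h`.
  have hall : ∀ h, P.Inside f S h → g (P.track h) = g (P.track h₀) := by
    intro h hh
    obtain ⟨r, hr1, hr2, hr3⟩ := hf.exists_return hP hS hh₀
    have h1 := hstep (r ++ h) (by rw [← List.append_assoc, inside_append, hr2]; exact ⟨hr1, hh⟩)
    rw [← h1]
    exact congrArg (P.val {top}) (transport_congr fun q hq => by
      rw [← List.append_assoc, P.track_append (h₀ ++ r), hr3 q (hCS hq)])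
  exact (hall h hh).trans (hall [] trivial).symm

end POMDP

/-! ### The Bhattacharyya coefficient -/

/-- The Bhattacharyya coefficient is one minus half the squared Hellinger distance; this gives both
that it is at most `1` and that it is strictly smaller for distinct distributions. -/
theorem sum_sqrt_mul_add {O : Type*} [Fintype O] {p q : O → ℝ} (hp : ∀ o, 0 ≤ p o)
    (hq : ∀ o, 0 ≤ q o) (hp1 : ∑ o, p o = 1) (hq1 : ∑ o, q o = 1) :
    ∑ o, √(p o * q o) + (∑ o, (√(p o) - √(q o)) ^ 2) / 2 = 1 := by
  have h : ∀ o, √(p o * q o) + (√(p o) - √(q o)) ^ 2 / 2 = p o / 2 + q o / 2 := by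
    intro o
    rw [Real.sqrt_mul (hp o)]
    linear_combination (Real.sq_sqrt (hp o)) / 2 + (Real.sq_sqrt (hq o)) / 2
  rw [Finset.sum_div, ← Finset.sum_add_distrib, Finset.sum_congr rfl fun o _ => h o,
    Finset.sum_add_distrib, ← Finset.sum_div, ← Finset.sum_div, hp1, hq1]
  norm_num

theorem sum_sqrt_mul_le_one {O : Type*} [Fintype O] {p q : O → ℝ} (hp : ∀ o, 0 ≤ p o)
    (hq : ∀ o, 0 ≤ q o) (hp1 : ∑ o, p o = 1) (hq1 : ∑ o, q o = 1) :
    ∑ o, √(p o * q o) ≤ 1 := by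
  have := sum_sqrt_mul_add hp hq hp1 hq1
  have : 0 ≤ ∑ o, (√(p o) - √(q o)) ^ 2 := Finset.sum_nonneg fun o _ => sq_nonneg _
  linarith

theorem sum_sqrt_mul_lt_one {O : Type*} [Fintype O] {p q : O → ℝ} (hp : ∀ o, 0 ≤ p o)
    (hq : ∀ o, 0 ≤ q o) (hp1 : ∑ o, p o = 1) (hq1 : ∑ o, q o = 1) {o : O} (hne : p o ≠ q o) :
    ∑ o, √(p o * q o) < 1 := by
  have := sum_sqrt_mul_add hp hq hp1 hq1
  have h1 : √(p o) - √(q o) ≠ 0 := fun h => hne ((Real.sqrt_inj (hp o) (hq o)).1 (sub_eq_zero.1 h))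
  have : 0 < ∑ o, (√(p o) - √(q o)) ^ 2 :=
    Finset.sum_pos' (fun o _ => sq_nonneg _) ⟨o, Finset.mem_univ o, by positivity⟩
  linarith

/-- The sum of the geometric means of the pairs of distinct weights. -/
noncomputable def affinity {ι : Type*} [Fintype ι] (lam : ι → ℝ) : ℝ :=
  open Classical in ∑ i, ∑ j, if i = j then 0 else √(lam i * lam j)

section affinity

variable {ι : Type*} [Fintype ι]

theorem affinity_nonneg (lam : ι → ℝ) : 0 ≤ affinity lam := by
  classical
  refine Finset.sum_nonneg fun i _ => Finset.sum_nonneg fun j _ => ?_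
  split_ifs
  exacts [le_rfl, Real.sqrt_nonneg _]

/-- Summing over the observations multiplies the term of each pair by the Bhattacharyya coefficient
of its two laws, which is at most `1`. Of all these savings only that of the ordered pair `(i, j)`
is kept. -/
theorem sum_affinity_le {O : Type*} [Fintype O] {lam : ι → ℝ} (hlam : ∀ i, 0 ≤ lam i)
    {p : ι → O → ℝ} (hp : ∀ i o, 0 ≤ p i o) (hp1 : ∀ i, ∑ o, p i o = 1) {i j : ι} (hij : i ≠ j) :
    ∑ o, affinity (fun k => lam k * p k o) ≤
      affinity lam - (1 - ∑ o, √(p i o * p j o)) * √(lam i * lam j) := by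
  classical
  have h1 : ∑ o, affinity (fun k => lam k * p k o) =
      ∑ k, ∑ l, (if k = l then 0 else √(lam k * lam l)) * ∑ o, √(p k o * p l o) := by
    simp only [affinity]
    rw [Finset.sum_comm]
    refine Finset.sum_congr rfl fun k _ => ?_
    rw [Finset.sum_comm]
    refine Finset.sum_congr rfl fun l _ => ?_
    rw [Finset.mul_sum]
    refine Finset.sum_congr rfl fun o _ => ?_
    split_ifs
    · simp
    · rw [mul_mul_mul_comm, Real.sqrt_mul (mul_nonneg (hlam k) (hlam l))]
  have h2 : ∀ k l, 0 ≤ (if k = l then 0 else √(lam k * lam l)) * (1 - ∑ o, √(p k o * p l o)) := by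
    intro k l
    refine mul_nonneg ?_ (sub_nonneg.2 (sum_sqrt_mul_le_one (hp k) (hp l) (hp1 k) (hp1 l)))
    split_ifs
    exacts [le_rfl, Real.sqrt_nonneg _]
  have h3 : affinity lam - ∑ o, affinity (fun k => lam k * p k o) =
      ∑ k, ∑ l, (if k = l then 0 else √(lam k * lam l)) * (1 - ∑ o, √(p k o * p l o)) := by
    rw [h1, affinity]
    simp only [mul_sub, mul_one, Finset.sum_sub_distrib]
  have h4 := (Finset.single_le_sum (fun l _ => h2 i l) (Finset.mem_univ j)).trans
    (Finset.single_le_sum (f := fun k => ∑ l, (if k = l then 0 else √(lam k * lam l)) *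
      (1 - ∑ o, √(p k o * p l o))) (fun k _ => Finset.sum_nonneg fun l _ => h2 k l)
      (Finset.mem_univ i))
  rw [← h3, if_neg hij] at h4
  linarith

/-- Among at most `|ι|²` terms the largest is at least their average; positivity of the sum rules
out that it is a diagonal term, since these are `0`. -/
theorem exists_affinity_le (lam : ι → ℝ) (h : 0 < affinity lam) :
    ∃ i j, i ≠ j ∧ affinity lam ≤ (Fintype.card ι : ℝ) ^ 2 * √(lam i * lam j) := by
  classical
  set t : ι × ι → ℝ := fun z => if z.1 = z.2 then 0 else √(lam z.1 * lam z.2) with ht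
  have hsum : affinity lam = ∑ z, t z := by
    rw [Fintype.sum_prod_type]; rfl
  have hne : Nonempty (ι × ι) := by
    by_contra hemp
    rw [not_nonempty_iff] at hemp
    rw [hsum, Finset.univ_eq_empty, Finset.sum_empty] at h
    exact lt_irrefl _ h
  obtain ⟨z, hz⟩ := Finite.exists_max t
  have hle : affinity lam ≤ (Fintype.card ι : ℝ) ^ 2 * t z := by
    rw [hsum]
    refine (Finset.sum_le_card_nsmul _ _ _ fun y _ => hz y).trans ?_
    rw [nsmul_eq_mul, Finset.card_univ, Fintype.card_prod]
    push_cast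
    rw [sq]
  refine ⟨z.1, z.2, fun heq => ?_, ?_⟩
  · rw [ht] at hle
    simp only [heq, if_true, mul_zero] at hle
    linarith
  · refine hle.trans (mul_le_mul_of_nonneg_left ?_ (by positivity))
    simp only [ht]
    split_ifs
    exacts [Real.sqrt_nonneg _, le_rfl]

/-- Take `i` of greatest weight. Then `lam j ≤ √(lam i * lam j)` for every other `j`, so all the
other classes together are paid for by the affinity. -/
theorem exists_sum_le_affinity [Nonempty ι] {lam κ : ι → ℝ} (hlam : ∀ i, 0 ≤ lam i)
    (hκ1 : ∀ i, κ i ≤ 1) :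
    ∃ i, ∑ j, lam j * κ j ≤ lam i * κ i + affinity lam := by
  classical
  obtain ⟨i, hi⟩ := Finite.exists_max lam
  refine ⟨i, ?_⟩
  have h1 : ∑ j, lam j * κ j ≤
      ∑ j, ((if i = j then lam i * κ i else 0) + if i = j then 0 else √(lam i * lam j)) := by
    refine Finset.sum_le_sum fun j _ => ?_
    split_ifs with hij
    · rw [hij, add_zero]
    · rw [zero_add]
      refine (mul_le_of_le_one_right (hlam j) (hκ1 j)).trans ?_
      exact Real.le_sqrt_of_sq_le (by rw [sq]; exact mul_le_mul_of_nonneg_right (hi j) (hlam j))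
  refine h1.trans ?_
  rw [Finset.sum_add_distrib, Finset.sum_ite_eq, if_pos (Finset.mem_univ i)]
  refine add_le_add le_rfl ?_
  exact Finset.single_le_sum (f := fun k => ∑ l, if k = l then 0 else √(lam k * lam l))
    (fun k _ => Finset.sum_nonneg fun l _ => by
      split_ifs
      exacts [le_rfl, Real.sqrt_nonneg _]) (Finset.mem_univ i)

end affinity

namespace POMDP

/-! ### The value in a distinguishing support end component -/

variable {Q A O : Type u} [Fintype Q] [Fintype A] [Fintype O] {P : POMDP Q A O}
variable {f : ActionMap Q A} {S : Finset Q}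

/-- The sets `C i` are distinct equivalence classes of indistinguishable states. -/
structure AreClasses (P : POMDP Q A O) (f : ActionMap Q A) (S : Finset Q) {ι : Type*}
    (C : ι → Finset Q) : Prop where
  nonempty : ∀ i, (C i).Nonempty
  subset : ∀ i, C i ⊆ S
  indist : ∀ i, ∀ q ∈ C i, ∀ q' ∈ C i, P.Indist f S q q'
  not_indist : ∀ i j, i ≠ j → ∀ q ∈ C i, ∀ q' ∈ C j, ¬ P.Indist f S q q'

variable {ι : Type*} [Fintype ι]

/-- The mixture of the restrictions of `b` to the classes, transported by `x`. -/
noncomputable def mixture (C : ι → Finset Q) (b : Q → ℝ) (lam : ι → ℝ) (x : Q → Q) : Q → ℝ :=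
  ∑ i, lam i • transport (C i) b x

/-- What is lost in the mixture by not knowing the class. -/
noncomputable def gap (P : POMDP Q A O) (top : Q) (C : ι → Finset Q) (b : Q → ℝ) (lam : ι → ℝ)
    (x : Q → Q) : ℝ :=
  ∑ i, lam i * P.val {top} (transport (C i) b id) - P.val {top} (mixture C b lam x)

theorem mixture_nonneg {C : ι → Finset Q} {b : Q → ℝ} (hb : ∀ q, 0 ≤ b q) {lam : ι → ℝ}
    (hlam : ∀ i, 0 ≤ lam i) (x : Q → Q) (q : Q) : 0 ≤ mixture C b lam x q :=
  sum_nonneg_apply (fun i _ => smul_nonneg_apply (hlam i) (transport_nonneg hb x)) q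

theorem PosteriorDeterministic.push_mixture (hP : P.PosteriorDeterministic) {C : ι → Finset Q}
    (b : Q → ℝ) (lam : ι → ℝ) {h : List (A × O)} {a : A} {o : O} {p : ι → ℝ}
    (hp : ∀ i, ∀ q ∈ C i, P.stateObsProb (P.track h q) a o = p i) :
    P.push (mixture C b lam (P.track h)) a o =
      mixture C b (fun i => lam i * p i) (P.track (h ++ [(a, o)])) := by
  rw [mixture, push_sum]
  refine Finset.sum_congr rfl fun i _ => ?_
  rw [push_smul, hP.push_transport_track b (hp i), smul_smul]

variable [Nonempty A]

/-- Playing for the heaviest class alone already secures its share of the value, which by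
`val_transport_eq` has not changed along `h`. -/
theorem gap_le_affinity (hf : P.IsSEC f) (hP : P.PosteriorDeterministic)
    {top : Q} (htop : P.Absorbing top) (hS : S ∈ dom f) {C : ι → Finset Q}
    (hC : P.AreClasses f S C) {b : Q → ℝ} (hb : IsSubBelief b) {h : List (A × O)}
    (hh : P.Inside f S h) {lam : ι → ℝ} (hlam : ∀ i, 0 ≤ lam i) :
    gap P top C b lam (P.track h) ≤ affinity lam := by
  classical
  rcases isEmpty_or_nonempty ι with hι | hι
  · have : gap P top C b lam (P.track h) = 0 := by simp [gap, mixture, P.val_zero]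
    rw [this]
    exact affinity_nonneg _
  · obtain ⟨i, hi⟩ := exists_sum_le_affinity (κ := fun i => P.val {top} (transport (C i) b id))
      hlam fun i => by
        refine (P.val_le_mass _ (transport_nonneg hb.1 _)).trans ?_
        rw [mass_transport]
        exact (Finset.sum_le_univ_sum_of_nonneg hb.1).trans hb.2
    have h1 : lam i * P.val {top} (transport (C i) b id) ≤
        P.val {top} (mixture C b lam (P.track h)) := by
      rw [← hf.val_transport_eq hP htop hS (hC.subset i) (hC.indist i) hb.1 hh,
        ← P.val_smul _ (hlam i) (transport_nonneg hb.1 _)]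
      refine P.val_mono _ (smul_nonneg_apply (hlam i) (transport_nonneg hb.1 _)) fun q => ?_
      rw [mixture, Finset.sum_apply]
      exact Finset.single_le_sum (f := fun j => (lam j • transport (C j) b (P.track h)) q)
        (fun j _ => smul_nonneg_apply (hlam j) (transport_nonneg hb.1 _) q) (Finset.mem_univ i)
    rw [gap]
    linarith

/-- Playing `a` preserves the first term of the gap, because the weights of each class add up to the
old weight over the observations. By Bellman's inequality it can only decrease the total value of
the mixtures. -/
theorem gap_le_sum (hP : P.PosteriorDeterministic) {top : Q} (htop : P.Absorbing top)
    {C : ι → Finset Q} {b : Q → ℝ} (hb : ∀ q, 0 ≤ b q) {h : List (A × O)}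
    {lam : ι → ℝ} (hlam : ∀ i, 0 ≤ lam i) {a : A} {p : ι → O → ℝ} (hp1 : ∀ i, ∑ o, p i o = 1)
    (hp : ∀ i o, ∀ q ∈ C i, P.stateObsProb (P.track h q) a o = p i o) :
    gap P top C b lam (P.track h) ≤
      ∑ o, gap P top C b (fun i => lam i * p i o) (P.track (h ++ [(a, o)])) := by
  have h1 := P.sum_val_push_le htop (mixture_nonneg (C := C) hb hlam (P.track h)) a
  rw [Finset.sum_congr rfl fun o _ =>
    congrArg (P.val {top}) (hP.push_mixture b lam fun i => hp i o)] at h1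
  simp only [gap, Finset.sum_sub_distrib]
  rw [Finset.sum_comm]
  simp only [← Finset.sum_mul, ← Finset.mul_sum, hp1, mul_one]
  linarith

theorem AreClasses.exists_common_obsProb {C : ι → Finset Q} (hC : P.AreClasses f S C)
    (hf : P.IsSEC f) (hP : P.PosteriorDeterministic) (hS : S ∈ dom f) {h : List (A × O)}
    (hh : P.Inside f S h) {a : A} (ha : a ∈ f (P.deltaStar S h)) :
    ∃ p : ι → O → ℝ, (∀ i o, 0 ≤ p i o) ∧ (∀ i, ∑ o, p i o = 1) ∧
      (∀ i o, 0 < p i o ↔ P.Inside f S (h ++ [(a, o)])) ∧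
      ∀ i o, ∀ q ∈ C i, P.stateObsProb (P.track h q) a o = p i o := by
  choose p h1 h2 h3 h4 using fun i =>
    hf.exists_common_obsProb hP hS (hC.nonempty i) (hC.subset i) (hC.indist i) hh ha
  exact ⟨p, h1, h2, h3, h4⟩

/-- Playing a history that distinguishes the classes `i` and `j` improves the bound on the gap. -/
theorem exists_gap_improvement (hf : P.IsSEC f) (hP : P.PosteriorDeterministic)
    {top : Q} (htop : P.Absorbing top) (hS : S ∈ dom f) {C : ι → Finset Q}
    (hC : P.AreClasses f S C) {b : Q → ℝ} (hb : IsSubBelief b) {i j : ι} (hij : i ≠ j)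
    (g h : List (A × O)) (hgh : P.Inside f S (h ++ g)) {a : A}
    (ha : a ∈ f (P.deltaStar S (h ++ g))) {o : O} {q q' : Q} (hq : q ∈ C i) (hq' : q' ∈ C j)
    (hne : P.stateObsProb (P.track (h ++ g) q) a o ≠ P.stateObsProb (P.track (h ++ g) q') a o) :
    ∃ τ : ℝ, 0 < τ ∧ ∀ K : ℝ, 0 ≤ K →
      (∀ h', P.Inside f S h' → ∀ lam : ι → ℝ, (∀ k, 0 ≤ lam k) →
        gap P top C b lam (P.track h') ≤ K * affinity lam) →
      ∀ lam : ι → ℝ, (∀ k, 0 ≤ lam k) →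
        gap P top C b lam (P.track h) ≤ K * affinity lam - K * τ * √(lam i * lam j) := by
  classical
  -- the bound after one action
  have bound : ∀ (h : List (A × O)) (a : A) (p : ι → O → ℝ), P.Inside f S h →
      (∀ k o, 0 ≤ p k o) → (∀ k o, 0 < p k o ↔ P.Inside f S (h ++ [(a, o)])) → ∀ K : ℝ, 0 ≤ K →
      (∀ h', P.Inside f S h' → ∀ lam : ι → ℝ, (∀ k, 0 ≤ lam k) →
        gap P top C b lam (P.track h') ≤ K * affinity lam) →
      ∀ lam : ι → ℝ, (∀ k, 0 ≤ lam k) → ∀ o,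
        gap P top C b (fun k => lam k * p k o) (P.track (h ++ [(a, o)])) ≤
          K * affinity (fun k => lam k * p k o) := by
    intro h a p hh hp0 hpos K hK H lam hlam o
    by_cases hin : P.Inside f S (h ++ [(a, o)])
    · exact H _ hin _ fun k => mul_nonneg (hlam k) (hp0 k o)
    · have hz : ∀ k, p k o = 0 := fun k =>
        ((hp0 k o).eq_or_lt.resolve_right fun hlt => hin ((hpos k o).1 hlt)).symm
      have : gap P top C b (fun k => lam k * p k o) (P.track (h ++ [(a, o)])) = 0 := by
        simp [gap, mixture, hz, P.val_zero]
      rw [this]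
      exact mul_nonneg hK (affinity_nonneg _)
  induction g generalizing h with
  | nil =>
    rw [List.append_nil] at hgh ha hne
    obtain ⟨p, hp0, hp1, hpos, hp⟩ := hC.exists_common_obsProb hf hP hS hgh ha
    rw [hp i o q hq, hp j o q' hq'] at hne
    -- Here `τ` is the Bhattacharyya defect of the two observation laws, positive because they
    -- differ at `o`.
    refine ⟨1 - ∑ o, √(p i o * p j o), sub_pos.2
      (sum_sqrt_mul_lt_one (hp0 i) (hp0 j) (hp1 i) (hp1 j) hne), fun K hK H lam hlam => ?_⟩
    refine (gap_le_sum hP htop hb.1 hlam hp1 hp).trans ?_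
    refine (Finset.sum_le_sum fun o _ => bound h a p hgh hp0 hpos K hK H lam hlam o).trans ?_
    rw [← Finset.mul_sum, mul_assoc, ← mul_sub]
    exact mul_le_mul_of_nonneg_left (sum_affinity_le hlam hp0 hp1 hij) hK
  | cons x g ih =>
    obtain ⟨a₁, o₁⟩ := x
    have e : h ++ (a₁, o₁) :: g = h ++ [(a₁, o₁)] ++ g := by simp
    rw [e] at hgh ha hne
    obtain ⟨τ, hτ, hτK⟩ := ih _ hgh ha hne
    have hin := (inside_append.1 hgh).1
    obtain ⟨hh, ha₁, -⟩ := inside_snoc.1 hin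
    obtain ⟨p, hp0, hp1, hpos, hp⟩ := hC.exists_common_obsProb hf hP hS hh ha₁
    have hpi := (hpos i o₁).2 hin
    have hpj := (hpos j o₁).2 hin
    -- Observing `o₁` multiplies `√(lam i * lam j)` by `√(p i o₁ * p j o₁)`. The later gain is used
    -- on this branch only; on the other branches the plain bound is enough.
    refine ⟨τ * √(p i o₁ * p j o₁), mul_pos hτ (Real.sqrt_pos.2 (mul_pos hpi hpj)),
      fun K hK H lam hlam => ?_⟩
    refine (gap_le_sum hP htop hb.1 hlam hp1 hp).trans ?_
    have h1 : ∀ o, gap P top C b (fun k => lam k * p k o) (P.track (h ++ [(a₁, o)])) ≤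
        K * affinity (fun k => lam k * p k o) -
          if o = o₁ then K * (τ * √(p i o₁ * p j o₁)) * √(lam i * lam j) else 0 := by
      intro o
      split_ifs with ho
      · subst ho
        refine (hτK K hK H _ fun k => mul_nonneg (hlam k) (hp0 k o)).trans_eq ?_
        rw [mul_mul_mul_comm, Real.sqrt_mul (mul_nonneg (hlam i) (hlam j))]
        ring
      · rw [sub_zero]
        exact bound h a₁ p hh hp0 hpos K hK H lam hlam o
    refine (Finset.sum_le_sum fun o _ => h1 o).trans ?_
    rw [Finset.sum_sub_distrib, ← Finset.mul_sum, Finset.sum_ite_eq', if_pos (Finset.mem_univ _)]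
    refine sub_le_sub_right (mul_le_mul_of_nonneg_left ?_ hK) _
    refine (sum_affinity_le hlam hp0 hp1 hij).trans (sub_le_self _ (mul_nonneg ?_
      (Real.sqrt_nonneg _)))
    exact sub_nonneg.2 (sum_sqrt_mul_le_one (hp0 i) (hp0 j) (hp1 i) (hp1 j))

theorem exists_pos_le_of_finite {Z : Type*} [Finite Z] {τ : Z → ℝ} (h : ∀ z, 0 < τ z) :
    ∃ ε, 0 < ε ∧ ε ≤ 1 ∧ ∀ z, ε ≤ τ z := by
  rcases isEmpty_or_nonempty Z with hZ | hZ
  · exact ⟨1, one_pos, le_rfl, fun z => hZ.elim z⟩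
  · obtain ⟨z, hz⟩ := Finite.exists_min τ
    exact ⟨min (τ z) 1, lt_min (h z) one_pos, min_le_right _ _,
      fun y => (min_le_left _ _).trans (hz y)⟩

/-- The bound on the gap can be improved by a factor that depends only on the component. -/
theorem exists_gap_contraction (hf : P.IsSEC f) (hP : P.PosteriorDeterministic)
    {top : Q} (htop : P.Absorbing top) (hS : S ∈ dom f) {C : ι → Finset Q}
    (hC : P.AreClasses f S C) {b : Q → ℝ} (hb : IsSubBelief b) :
    ∃ ρ : ℝ, 0 ≤ ρ ∧ ρ < 1 ∧ ∀ K : ℝ, 0 ≤ K →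
      (∀ h, P.Inside f S h → ∀ lam : ι → ℝ, (∀ k, 0 ≤ lam k) →
        gap P top C b lam (P.track h) ≤ K * affinity lam) →
      ∀ h, P.Inside f S h → ∀ lam : ι → ℝ, (∀ k, 0 ≤ lam k) →
        gap P top C b lam (P.track h) ≤ K * ρ * affinity lam := by
  classical
  -- The gap depends on the history only through the induced map. Indexing by the finitely many
  -- triples of a map and two distinct classes makes a uniform positive gain possible.
  have exists_local : ∀ z : {z : (Q → Q) × ι × ι //
      (∃ h, P.Inside f S h ∧ P.track h = z.1) ∧ z.2.1 ≠ z.2.2},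
      ∃ τ : ℝ, 0 < τ ∧ ∀ K : ℝ, 0 ≤ K →
      (∀ h', P.Inside f S h' → ∀ lam : ι → ℝ, (∀ k, 0 ≤ lam k) →
        gap P top C b lam (P.track h') ≤ K * affinity lam) →
      ∀ lam : ι → ℝ, (∀ k, 0 ≤ lam k) → gap P top C b lam z.1.1 ≤
        K * affinity lam - K * τ * √(lam z.1.2.1 * lam z.1.2.2) := by
    rintro ⟨⟨x, i, j⟩, ⟨h, hh, hx⟩, hij⟩
    dsimp only at hx hij ⊢
    subst hx
    obtain ⟨q, hq⟩ := hC.nonempty i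
    obtain ⟨q', hq'⟩ := hC.nonempty j
    have hnot := hC.not_indist i j hij q hq q' hq'
    rw [hf.indist_iff hP hS (hC.subset i hq) (hC.subset j hq')] at hnot
    push Not at hnot
    obtain ⟨g, hg, a, ha, o, hne⟩ := hnot
    -- The word `g` distinguishes the classes from the support `S`, so the history is first
    -- continued by `r` until it acts as the identity on `S`.
    obtain ⟨r, hr1, hr2, hr3⟩ := hf.exists_return hP hS hh
    refine exists_gap_improvement hf hP htop hS hC hb hij (r ++ g) h ?_ (a := a) ?_ (o := o) hq hq'
      ?_
    · rw [← List.append_assoc, inside_append, hr2]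
      exact ⟨hr1, hg⟩
    · rwa [← List.append_assoc, deltaStar_append, hr2]
    · rwa [← List.append_assoc, P.track_append (h ++ r), P.track_append (h ++ r),
        hr3 q (hC.subset i hq), hr3 q' (hC.subset j hq')]
  choose τ hτ hτK using exists_local
  obtain ⟨ε, hε0, hε1, hετ⟩ := exists_pos_le_of_finite hτ
  -- The square counts the pairs of classes in `exists_affinity_le`; the `+ 1` ensures `1 ≤ N`,
  -- hence `ε / N ≤ 1` and a nonnegative contraction factor.
  set N : ℝ := (Fintype.card ι : ℝ) ^ 2 + 1 with hN
  have hN1 : 1 ≤ N := by rw [hN]; nlinarith [sq_nonneg (Fintype.card ι : ℝ)]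
  have hεN : ε / N ≤ 1 := (div_le_one (by linarith)).2 (hε1.trans hN1)
  have hεN0 : 0 < ε / N := by positivity
  refine ⟨1 - ε / N, by linarith, by linarith, fun K hK H h hh lam hlam => ?_⟩
  rcases (affinity_nonneg lam).eq_or_lt with h0 | h0
  · have := H h hh lam hlam
    rw [← h0, mul_zero] at this ⊢
    exact this
  · obtain ⟨i, j, hij, hle⟩ := exists_affinity_le lam h0
    refine (hτK ⟨(P.track h, i, j), ⟨h, hh, rfl⟩, hij⟩ K hK H lam hlam).trans ?_
    dsimp only
    have h1 := hετ ⟨(P.track h, i, j), ⟨h, hh, rfl⟩, hij⟩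
    have h2 : affinity lam / N ≤ √(lam i * lam j) := by
      rw [div_le_iff₀ (by linarith), hN]
      nlinarith [Real.sqrt_nonneg (lam i * lam j)]
    have h3 : ε * (affinity lam / N) ≤ τ ⟨(P.track h, i, j), ⟨h, hh, rfl⟩, hij⟩ *
        √(lam i * lam j) :=
      mul_le_mul h1 h2 (div_nonneg h0.le (by linarith)) (hε0.le.trans h1)
    have h4 := mul_le_mul_of_nonneg_left h3 hK
    have h5 : K * (1 - ε / N) * affinity lam =
        K * affinity lam - K * (ε * (affinity lam / N)) := by ring
    rw [h5, mul_assoc]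
    linarith

/-- The bound of `gap_le_affinity`, with constant `1`, is contracted repeatedly, and its constant `ρ
^ n` tends to `0`. -/
theorem gap_nonpos (hf : P.IsSEC f) (hP : P.PosteriorDeterministic)
    {top : Q} (htop : P.Absorbing top) (hS : S ∈ dom f) {C : ι → Finset Q}
    (hC : P.AreClasses f S C) {b : Q → ℝ} (hb : IsSubBelief b) {h : List (A × O)}
    (hh : P.Inside f S h) {lam : ι → ℝ} (hlam : ∀ i, 0 ≤ lam i) :
    gap P top C b lam (P.track h) ≤ 0 := by
  obtain ⟨ρ, hρ0, hρ1, hρ⟩ := exists_gap_contraction hf hP htop hS hC hb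
  have key : ∀ n : ℕ, ∀ h, P.Inside f S h → ∀ lam : ι → ℝ, (∀ k, 0 ≤ lam k) →
      gap P top C b lam (P.track h) ≤ ρ ^ n * affinity lam := by
    intro n
    induction n with
    | zero =>
      intro h hh lam hlam
      simpa using gap_le_affinity hf hP htop hS hC hb hh hlam
    | succ n ih =>
      rw [pow_succ]
      exact hρ _ (pow_nonneg hρ0 n) ih
  have hlim := (tendsto_pow_atTop_nhds_zero_of_lt_one hρ0 hρ1).mul_const (affinity lam)
  rw [zero_mul] at hlim
  exact ge_of_tendsto' hlim fun n => key n h hh lam hlam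

/-- Inside a support end component the class of indistinguishable states can be learned. -/
theorem sum_val_transport_le (hf : P.IsSEC f) (hP : P.PosteriorDeterministic)
    {top : Q} (htop : P.Absorbing top) (hS : S ∈ dom f) {C : ι → Finset Q}
    (hC : P.AreClasses f S C) {b : Q → ℝ} (hb : IsSubBelief b) :
    ∑ i, P.val {top} (transport (C i) b id) ≤ P.val {top} (∑ i, transport (C i) b id) := by
  have h := gap_nonpos hf hP htop hS hC hb (h := []) trivial (lam := fun _ => 1)
    fun _ => zero_le_one
  have e : P.track ([] : List (A × O)) = id := rfl
  simp only [gap, mixture, one_mul, one_smul, e] at h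
  linarith

end POMDP

namespace POMDP

variable {Q A O : Type u} [Fintype Q] [Fintype A] [Fintype O] {P : POMDP Q A O}

/-! ### The rank -/

theorem suppLeTot_card_le (hP : P.PosteriorDeterministic) {S T : Finset Q}
    (h : P.suppLeTot S T) : S.card ≤ T.card := by
  rcases h with ⟨h, rfl⟩ | h
  exacts [hP.card_deltaStar_le _ _, h.le]

/-- The mixed cases work because reachability does not increase the size of a support. -/
theorem suppLeTot_trans (hP : P.PosteriorDeterministic) {S T U : Finset Q}
    (h₁ : P.suppLeTot S T) (h₂ : P.suppLeTot T U) : P.suppLeTot S U := by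
  rcases h₁ with ⟨g, rfl⟩ | h
  · rcases h₂ with ⟨h, rfl⟩ | h
    · exact Or.inl ⟨h ++ g, P.deltaStar_append _ _ _⟩
    · exact Or.inr ((hP.card_deltaStar_le _ _).trans_lt h)
  · exact Or.inr (h.trans_le (suppLeTot_card_le hP h₂))

theorem suppLtTot_trans (hP : P.PosteriorDeterministic) {S T U : Finset Q}
    (h₁ : P.suppLtTot S T) (h₂ : P.suppLtTot T U) : P.suppLtTot S U :=
  ⟨suppLeTot_trans hP h₁.1 h₂.1, fun h => h₁.2 (suppLeTot_trans hP h₂.1 h)⟩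

/-- The members of a strict chain are distinct supports. The resulting uniform bound keeps the
supremum defining the rank, and later the suprema at max nodes, from being taken over unbounded
sets. -/
theorem chain_length_le (hP : P.PosteriorDeterministic) {c : ℕ → Finset Q} {k : ℕ}
    (hc : ∀ i < k, P.suppLtTot (c i) (c (i + 1))) : k ≤ Fintype.card (Finset Q) := by
  have hlt : ∀ d i, i + d + 1 ≤ k → P.suppLtTot (c i) (c (i + d + 1)) := by
    intro d i
    induction d with
    | zero => exact fun h => hc i h
    | succ d ih => exact fun h => suppLtTot_trans hP (ih (by omega)) (hc _ (by omega))
  have hinj : Function.Injective fun i : Fin k => c i := by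
    intro i j hij
    by_contra hne
    have hirr : ∀ i j : Fin k, i < j → c i ≠ c j := by
      intro i j hlt' heq
      have := hlt (j - i - 1) i (by omega)
      rw [show (i : ℕ) + (j - i - 1) + 1 = j by omega, heq] at this
      exact this.2 this.1
    rcases lt_or_gt_of_ne hne with h | h
    exacts [hirr _ _ h hij, hirr _ _ h hij.symm]
  simpa using Fintype.card_le_of_injective _ hinj

theorem bddAbove_chain (hP : P.PosteriorDeterministic) (S : Finset Q) :
    BddAbove {k | ∃ c : ℕ → Finset Q, (∀ i ≤ k, (c i).Nonempty) ∧
      (∀ i < k, P.suppLtTot (c i) (c (i + 1))) ∧ c k = S} :=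
  ⟨_, fun _ ⟨_, _, hc, _⟩ => chain_length_le hP hc⟩

theorem rankSupp_le (hP : P.PosteriorDeterministic) (S : Finset Q) :
    P.rankSupp S ≤ Fintype.card (Finset Q) := by
  rcases Set.eq_empty_or_nonempty {k | ∃ c : ℕ → Finset Q, (∀ i ≤ k, (c i).Nonempty) ∧
      (∀ i < k, P.suppLtTot (c i) (c (i + 1))) ∧ c k = S} with h | h
  · rw [rankSupp, h]; simp
  · exact csSup_le h fun _ ⟨_, _, hc, _⟩ => chain_length_le hP hc

theorem one_le_rankSupp_of_lt (hP : P.PosteriorDeterministic) {S T : Finset Q} (hT : T.Nonempty)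
    (hS : S.Nonempty) (h : P.suppLtTot T S) : 1 ≤ P.rankSupp S := by
  refine le_csSup (bddAbove_chain hP S) ⟨fun i => if i = 0 then T else S, fun i _ => ?_, ?_, ?_⟩
  · dsimp only
    split_ifs
    exacts [hT, hS]
  · intro i hi
    obtain rfl : i = 0 := by omega
    simpa using h
  · simp

theorem deltaStar_top {top : Q} (htop : P.Absorbing top) (h : List (A × O)) :
    P.deltaStar {top} h ⊆ {top} := by
  have hmono : ∀ S : Finset Q, S ⊆ {top} → P.deltaStar S h ⊆ {top} := by
    induction h with
    | nil => exact fun S hS => hS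
    | cons x h ih =>
      refine fun S hS => ih _ fun q' hq' => ?_
      obtain ⟨q, hq, hT⟩ := P.mem_delta.1 hq'
      rw [Finset.mem_singleton.1 (hS hq)] at hT
      exact Finset.mem_singleton.2 (htop _ _ _ hT)
  exact hmono _ subset_rfl

theorem deltaStar_mono {S T : Finset Q} (hST : S ⊆ T) (h : List (A × O)) :
    P.deltaStar S h ⊆ P.deltaStar T h := by
  induction h generalizing S T with
  | nil => exact hST
  | cons x h ih =>
    refine ih fun q' hq' => ?_
    obtain ⟨q, hq, hT⟩ := P.mem_delta.1 hq'
    exact P.mem_delta.2 ⟨q, hST hq, hT⟩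

theorem exists_history_of_reachWithin_pos {top : Q} (htop : P.Absorbing top) (n : ℕ)
    (σ : Strategy A O) (q : Q) (h : 0 < P.reachWithin {top} n σ q) :
    ∃ g : List (A × O), top ∈ P.deltaStar {q} g := by
  induction n generalizing σ q with
  | zero =>
    by_cases hq : q = top
    · exact ⟨[], by simp [hq]⟩
    · rw [P.reachWithin_zero_of_notMem _ _ (by simpa using hq)] at h
      exact absurd h (lt_irrefl _)
  | succ n ih =>
    rw [P.reachWithin_succ htop] at h
    obtain ⟨a, -, ha⟩ := Finset.exists_ne_zero_of_sum_ne_zero h.ne'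
    obtain ⟨o, -, ho⟩ := Finset.exists_ne_zero_of_sum_ne_zero (right_ne_zero_of_mul ha)
    obtain ⟨q', -, hq'⟩ := Finset.exists_ne_zero_of_sum_ne_zero ho
    obtain ⟨g, hg⟩ := ih _ q' ((P.reachWithin_nonneg _ _ _ _).lt_of_ne'
      (right_ne_zero_of_mul hq'))
    refine ⟨(a, o) :: g, deltaStar_mono (Finset.singleton_subset_iff.2 ?_) g hg⟩
    exact P.mem_delta.2 ⟨q, Finset.mem_singleton_self q, (P.T_nonneg _ _ _ _).lt_of_ne'
      (left_ne_zero_of_mul hq')⟩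

/-- A nonzero value gives a positive probability of reaching `top` within finitely many steps, hence
a history leading there. The support stays of size at most one, so it becomes exactly `{top}`. -/
theorem exists_deltaStar_eq_top [Nonempty A] (hP : P.PosteriorDeterministic) {top : Q}
    (htop : P.Absorbing top) {q : Q} (hq : P.val {top} (dirac q) ≠ 0) :
    ∃ g : List (A × O), P.deltaStar {q} g = {top} := by
  classical
  have hpos := (P.val_nonneg {top} (dirac_nonneg q)).lt_of_ne' hq
  obtain ⟨σ, hσ⟩ := P.exists_lt_reachFrom {top} (dirac_nonneg q) hpos
  have h1 : P.reachFrom {top} (dirac q) σ = P.reachProb {top} σ q := by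
    simp [reachFrom, dirac]
  rw [h1] at hσ
  obtain ⟨n, hn⟩ := (Filter.Tendsto.eventually_const_lt hσ (P.tendsto_reachWithin {top} σ q)).exists
  obtain ⟨g, hg⟩ := exists_history_of_reachWithin_pos htop n σ q hn
  refine ⟨g, (Finset.eq_of_subset_of_card_le (Finset.singleton_subset_iff.2 hg) ?_).symm⟩
  exact hP.card_deltaStar_le _ _

/-- A support with at least two states lies strictly above a singleton by size. A singleton other
than `{top}` and `{bot}` lies strictly above `{top}`: its state has nonzero value and so leads to
`top`, and nothing leads back. -/
theorem one_le_rankSupp [Nonempty A] (hP : P.PosteriorDeterministic) {top bot : Q}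
    (htop : P.Absorbing top) (hbot : ∀ q, P.val {top} (dirac q) = 0 ↔ q = bot) {S : Finset Q}
    (hS : S.Nonempty) (hStop : S ≠ {top}) (hSbot : S ≠ {bot}) : 1 ≤ P.rankSupp S := by
  obtain ⟨q, hq⟩ := hS
  rcases Nat.lt_or_ge 1 S.card with hcard | hcard
  · refine one_le_rankSupp_of_lt hP (Finset.singleton_nonempty q) ⟨q, hq⟩
      ⟨Or.inr (by simpa using hcard), fun h => ?_⟩
    have := suppLeTot_card_le hP h
    rw [Finset.card_singleton] at this
    omega
  · obtain rfl : {q} = S := Finset.eq_of_subset_of_card_le (Finset.singleton_subset_iff.2 hq)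
      (by simpa using hcard)
    obtain ⟨g, hg⟩ := exists_deltaStar_eq_top hP htop
      (mt (hbot q).1 fun h => hSbot (by rw [h]))
    refine one_le_rankSupp_of_lt hP (Finset.singleton_nonempty top) ⟨q, hq⟩
      ⟨Or.inl ⟨g, hg⟩, ?_⟩
    rintro (⟨g', hg'⟩ | h)
    · have := deltaStar_top htop g'
      rw [hg', Finset.singleton_subset_iff, Finset.mem_singleton] at this
      exact hStop (by rw [this])
    · simp at h

/-! ### Supports and values -/

theorem mem_supp {b : Q → ℝ} {q : Q} : q ∈ supp b ↔ 0 < b q := by simp [supp]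

theorem restrict_supp {b : Q → ℝ} (hb : ∀ q, 0 ≤ b q) : restrict b (supp b) = b := by
  ext q
  by_cases h : q ∈ supp b
  · simp [restrict, h]
  · simp only [restrict, h, if_false]
    exact (hb q).antisymm (not_lt.1 (mt mem_supp.2 h))

theorem supp_smul {c : ℝ} (hc : 0 < c) (b : Q → ℝ) : supp (c • b) = supp b := by
  ext q
  simp [mem_supp, hc]

theorem supp_nonempty {b : Q → ℝ} (hb : ∀ q, 0 ≤ b q) (h : 0 < mass b) : (supp b).Nonempty := by
  rw [Finset.nonempty_iff_ne_empty]
  intro he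
  have hz : b = 0 := by
    rw [← restrict_supp hb, he]
    ext; simp [restrict]
  rw [hz] at h
  simp [mass] at h

theorem mass_pos {b : Q → ℝ} (hb : ∀ q, 0 ≤ b q) (h : (supp b).Nonempty) : 0 < mass b := by
  obtain ⟨q, hq⟩ := h
  exact Finset.sum_pos' (fun q _ => hb q) ⟨q, Finset.mem_univ q, mem_supp.1 hq⟩

theorem eq_zero_of_supp_eq {b : Q → ℝ} (hb : ∀ q, 0 ≤ b q) {q : Q} (h : supp b = {q}) {r : Q}
    (hr : r ≠ q) : b r = 0 :=
  (hb r).antisymm' (not_lt.1 fun hlt => hr (by simpa [h] using mem_supp.2 hlt))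

theorem eq_smul_dirac {b : Q → ℝ} {q : Q} (hz : ∀ r, r ≠ q → b r = 0) :
    b = mass b • dirac q := by
  classical
  have hm : mass b = b q := Finset.sum_eq_single q (fun r _ hr => hz r hr) (by simp)
  ext r
  by_cases hr : r = q
  · simp [hr, hm, dirac]
  · simp [hr, hz r hr, dirac]

theorem val_dirac_of_mem [Nonempty A] (G : Set Q) {q : Q} (hq : q ∈ G) :
    P.val G (dirac q) = 1 := by
  classical
  refine le_antisymm ((P.val_le_mass G (dirac_nonneg q)).trans_eq (mass_dirac q)) ?_
  obtain ⟨σ⟩ : Nonempty (Strategy A O) := inferInstance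
  refine le_trans ?_ (P.reachFrom_le_val G (dirac_nonneg q) σ)
  simp [reachFrom, dirac, P.reachProb_of_mem G σ hq]

theorem val_of_eq_zero_of_ne_top [Nonempty A] {top : Q} {b : Q → ℝ} (hb : ∀ q, 0 ≤ b q)
    (h : ∀ q, q ≠ top → b q = 0) : P.val {top} b = mass b := by
  rw [eq_smul_dirac h, P.val_smul _ (mass_nonneg hb) (dirac_nonneg _),
    val_dirac_of_mem _ (Set.mem_singleton top), mass_smul, mass_dirac]

theorem val_of_supp_eq_bot [Nonempty A] {top bot : Q} {b : Q → ℝ} (hb : ∀ q, 0 ≤ b q)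
    (hbot : P.val {top} (dirac bot) = 0) (h : supp b = {bot}) : P.val {top} b = 0 := by
  rw [eq_smul_dirac fun _ => eq_zero_of_supp_eq hb h,
    P.val_smul _ (mass_nonneg hb) (dirac_nonneg _), hbot, mul_zero]

theorem rank_nonneg {b : Q → ℝ} (hb : ∀ q, 0 ≤ b q) : 0 ≤ P.rank b :=
  mul_nonneg (mass_nonneg hb) (Nat.cast_nonneg _)

theorem rank_le (hP : P.PosteriorDeterministic) {b : Q → ℝ} (hb : IsSubBelief b) :
    P.rank b ≤ Fintype.card (Finset Q) := by
  have h1 : (P.rankSupp (supp b) : ℝ) ≤ Fintype.card (Finset Q) := by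
    exact_mod_cast rankSupp_le hP _
  exact (mul_le_of_le_one_left (Nat.cast_nonneg _) hb.2).trans h1

theorem mass_le_rank [Nonempty A] (hP : P.PosteriorDeterministic) {top bot : Q}
    (htop : P.Absorbing top) (hbot : ∀ q, P.val {top} (dirac q) = 0 ↔ q = bot) {b : Q → ℝ}
    (hb : ∀ q, 0 ≤ b q) (hbtop : supp b ≠ {top}) (hbbot : supp b ≠ {bot}) :
    mass b ≤ P.rank b := by
  rcases (mass_nonneg hb).eq_or_lt with h | h
  · rw [rank, ← h, zero_mul]
  · refine le_mul_of_one_le_right h.le ?_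
    exact_mod_cast one_le_rankSupp hP htop hbot (supp_nonempty hb h) hbtop hbbot

/-- The estimates at a leaf. -/
theorem val_le_leaf [Nonempty A] (hP : P.PosteriorDeterministic) {top bot : Q}
    (htop : P.Absorbing top) (hbot : ∀ q, P.val {top} (dirac q) = 0 ↔ q = bot) {b : Q → ℝ}
    (hb : ∀ q, 0 ≤ b q) :
    P.val {top} b ≤ (open Classical in if supp b = {top} then mass b else 0) + P.rank b := by
  split_ifs with h
  · exact (P.val_le_mass _ hb).trans (le_add_of_nonneg_right (rank_nonneg hb))
  · rw [zero_add]
    by_cases h' : supp b = {bot}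
    · rw [val_of_supp_eq_bot hb ((hbot bot).2 rfl) h']
      exact rank_nonneg hb
    · exact (P.val_le_mass _ hb).trans (mass_le_rank hP htop hbot hb h h')

end POMDP

namespace POMDP

variable {Q A O : Type u} [Fintype Q] [Fintype A] [Fintype O] {P : POMDP Q A O}
variable {f : ActionMap Q A}

/-! ### Non-distinguishing support end components -/

/-- If `top` were in a support, an allowed action followed by the observation specific to `top`
would shrink the support to `{top}`. From there only `{top}` or the empty set can be reached, never
`S`. -/
theorem IsSEC.top_notMem (hf : P.IsSEC f) {top : Q}
    (htop : P.Absorbing top) (htop' : P.Observable top) {S : Finset Q} (hS : S ∈ dom f)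
    (hStop : S ≠ {top}) {T : Finset Q} (hT : T ∈ dom f) : top ∉ T := by
  intro hmem
  obtain ⟨a, ha⟩ := id hT
  obtain ⟨o₀, ho₀⟩ := htop'
  obtain ⟨o, q', hpos⟩ : ∃ o q', 0 < P.T top a o q' := by
    by_contra! hcon
    have h1 := P.T_sum top a
    rw [Finset.sum_eq_zero fun o _ => Finset.sum_eq_zero fun q' _ =>
      (hcon o q').antisymm (P.T_nonneg _ _ _ _)] at h1
    exact zero_ne_one h1
  obtain rfl := htop _ _ _ hpos
  obtain rfl := (ho₀ _ _ _ _ hpos).2 rfl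
  have h1 : P.delta T a o = {q'} := by
    ext r
    rw [P.mem_delta, Finset.mem_singleton]
    constructor
    · rintro ⟨q, -, hq⟩
      exact (ho₀ _ _ _ _ hq).1 rfl
    · rintro rfl
      exact ⟨r, hmem, hpos⟩
  have h2 : ({q'} : Finset Q) ∈ dom f := h1 ▸ hf.closed T hT a ha o (by simp [h1])
  obtain ⟨h, -, hh⟩ := hf.connected _ h2 S hS
  have h3 := deltaStar_top htop h
  rw [hh, Finset.subset_singleton_iff] at h3
  exact h3.elim (hf.nonempty_of_mem S hS).ne_empty hStop

/-- A sub-belief in a non-distinguishing support end component. -/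
structure InNondist (P : POMDP Q A O) (f : ActionMap Q A) (b : Q → ℝ) : Prop where
  isSEC : P.IsSEC f
  mem : supp b ∈ dom f
  nondist : ¬ P.Distinguishing f

theorem InNondist.indist {b : Q → ℝ} (hf : P.InNondist f b) :
    ∀ q ∈ supp b, ∀ q' ∈ supp b, P.Indist f (supp b) q q' := by
  intro q hq q' hq'
  by_contra h
  exact hf.nondist ⟨_, hf.mem, q, hq, q', hq', h⟩

theorem IsSEC.supp_transport_track (hf : P.IsSEC f) (hP : P.PosteriorDeterministic) {b : Q → ℝ}
    (hb : ∀ q, 0 ≤ b q) (hS : supp b ∈ dom f) {h : List (A × O)} (hh : P.Inside f (supp b) h) :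
    supp (transport (supp b) b (P.track h)) = P.deltaStar (supp b) h := by
  classical
  ext r
  rw [supp_transport hb fun q hq => mem_supp.1 hq, hf.deltaStar_eq hP hS hh, Finset.mem_image]

theorem sum_supp {b : Q → ℝ} (hb : ∀ q, 0 ≤ b q) : ∑ q ∈ supp b, b q = mass b :=
  Finset.sum_subset (Finset.subset_univ _) fun q _ hq =>
    (hb q).antisymm' (not_lt.1 (mt mem_supp.2 hq))

/-- All states emit each observation with the same probability, so conditioning does not reweight
them; rescaling by `mass b` restores the original weights, moved along the history. -/
theorem InNondist.reachBelief_eq {b c : Q → ℝ} (hf : P.InNondist f b)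
    (hP : P.PosteriorDeterministic) (hb : ∀ q, 0 ≤ b q) (hc : P.ReachBelief f b c) :
    ∃ h, P.Inside f (supp b) h ∧ c = transport (supp b) b (P.track h) := by
  induction hc with
  | refl => exact ⟨[], trivial, by rw [transport_id _ _ fun q _ => P.track_nil q, restrict_supp hb]⟩
  | step c a o _ ha ho ih =>
    obtain ⟨h, hh, rfl⟩ := ih
    rw [hf.isSEC.supp_transport_track hP hb hf.mem hh] at ha
    obtain ⟨p, hp0, -, hppos, hp⟩ := hf.isSEC.exists_common_obsProb hP hf.mem
      (hf.isSEC.nonempty_of_mem _ hf.mem) subset_rfl hf.indist hh ha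
    have h1 := hP.push_transport_track b (hp o)
    have h2 : P.obsProb (transport (supp b) b (P.track h)) a o = p o * mass b := by
      rw [← mass_push, h1, mass_smul, mass_transport, sum_supp hb]
    rw [h2] at ho
    have hpo : 0 < p o := pos_of_mul_pos_left ho (mass_nonneg hb)
    have hm : mass b ≠ 0 := right_ne_zero_of_mul ho.ne'
    refine ⟨h ++ [(a, o)], (hppos o).1 hpo, ?_⟩
    rw [P.update_eq, h1, h2, smul_smul, smul_smul]
    rw [show mass b * (p o * mass b)⁻¹ * p o = 1 by field_simp, one_smul]

theorem InNondist.reachBelief_spec {b c : Q → ℝ} (hf : P.InNondist f b)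
    (hP : P.PosteriorDeterministic) (hb : ∀ q, 0 ≤ b q) (hc : P.ReachBelief f b c) :
    (∀ q, 0 ≤ c q) ∧ mass c = mass b ∧ supp c ∈ dom f := by
  obtain ⟨h, hh, rfl⟩ := hf.reachBelief_eq hP hb hc
  rw [hf.isSEC.supp_transport_track hP hb hf.mem hh, mass_transport, sum_supp hb]
  exact ⟨transport_nonneg hb _, rfl, hf.isSEC.deltaStar_mem_dom hf.mem hh⟩

variable [Nonempty A]

theorem InNondist.val_reachBelief {b c : Q → ℝ} (hf : P.InNondist f b)
    (hP : P.PosteriorDeterministic) {top : Q} (htop : P.Absorbing top) (hb : ∀ q, 0 ≤ b q)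
    (hc : P.ReachBelief f b c) : P.val {top} c = P.val {top} b := by
  obtain ⟨h, hh, rfl⟩ := hf.reachBelief_eq hP hb hc
  rw [hf.isSEC.val_transport_eq hP htop hf.mem subset_rfl hf.indist hb hh,
    transport_id (x := id) _ _ fun _ _ => rfl, restrict_supp hb]

/-- Plays that never leave the component never visit `top`, so only the exits contribute. The
assumption `0 ≤ B` covers a component without exits. -/
theorem InNondist.val_le {b : Q → ℝ} (hf : P.InNondist f b)
    (hP : P.PosteriorDeterministic) {top : Q} (htop : P.Absorbing top)
    (htop' : P.Observable top) (hb : ∀ q, 0 ≤ b q) (hbtop : supp b ≠ {top}) {B : ℝ} (hB : 0 ≤ B)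
    (h : ∀ c a, P.ReachBelief f b c → a ∉ f (supp c) → P.valAct {top} c a ≤ B) :
    P.val {top} b ≤ B := by
  refine P.val_le_of_stay htop {c | P.ReachBelief f b c}
    (mass_pos hb (hf.isSEC.nonempty_of_mem _ hf.mem)) hB ?_ ?_ ReachBelief.refl
  · intro c hc
    obtain ⟨h1, h2, h3⟩ := hf.reachBelief_spec hP hb hc
    refine ⟨h1, h2, (h1 top).antisymm' (not_lt.1 ?_)⟩
    exact mt mem_supp.2 (hf.isSEC.top_notMem htop htop' hf.mem hbtop h3)
  · intro c hc a
    by_cases ha : a ∈ f (supp c)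
    · exact Or.inr fun o ho => ReachBelief.step c a o hc ha ho
    · exact Or.inl (h c a hc ha)

/-! ### Distinguishing support end components -/

section classes

variable {S : Finset Q}

/-- Any member represents its class. Symmetry and transitivity are read off from `indist_iff`, where
every tracked state exists; in the definition of `Indist` an empty `deltaStar` would make the
condition vacuous. -/
theorem IsSEC.mem_classes_iff (hf : P.IsSEC f) (hP : P.PosteriorDeterministic) (hS : S ∈ dom f)
    {C : Finset Q} (hC : C ∈ P.classes f S) {q : Q} (hq : q ∈ C) {q' : Q} :
    q' ∈ C ↔ q' ∈ S ∧ P.Indist f S q q' := by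
  classical
  obtain ⟨q₀, hq₀, rfl⟩ := Finset.mem_image.1 hC
  obtain ⟨hqS, hqi⟩ := Finset.mem_filter.1 hq
  rw [Finset.mem_filter]
  refine and_congr_right fun hqS' => ?_
  rw [hf.indist_iff hP hS hq₀ hqS] at hqi
  rw [hf.indist_iff hP hS hq₀ hqS', hf.indist_iff hP hS hqS hqS']
  constructor
  · exact fun h' h hh a ha o => (hqi h hh a ha o).symm.trans (h' h hh a ha o)
  · exact fun h' h hh a ha o => (hqi h hh a ha o).trans (h' h hh a ha o)

theorem IsSEC.exists_mem_classes (hf : P.IsSEC f) (hP : P.PosteriorDeterministic) (hS : S ∈ dom f)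
    {q : Q} (hq : q ∈ S) : ∃ C ∈ P.classes f S, q ∈ C := by
  classical
  refine ⟨_, Finset.mem_image_of_mem _ hq, Finset.mem_filter.2 ⟨hq, ?_⟩⟩
  exact (hf.indist_iff hP hS hq hq).2 fun _ _ _ _ _ => rfl

theorem IsSEC.classes_eq_of_mem (hf : P.IsSEC f) (hP : P.PosteriorDeterministic) (hS : S ∈ dom f)
    {C C' : Finset Q} (hC : C ∈ P.classes f S) (hC' : C' ∈ P.classes f S) {q : Q} (hq : q ∈ C)
    (hq' : q ∈ C') : C = C' := by
  ext r
  rw [hf.mem_classes_iff hP hS hC hq, hf.mem_classes_iff hP hS hC' hq']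

theorem IsSEC.areClasses (hf : P.IsSEC f) (hP : P.PosteriorDeterministic) (hS : S ∈ dom f) :
    P.AreClasses f S fun C : {C // C ∈ P.classes f S} => C.1 where
  nonempty := by
    classical
    rintro ⟨C, hC⟩
    obtain ⟨q, hq, rfl⟩ := Finset.mem_image.1 hC
    exact ⟨q, Finset.mem_filter.2 ⟨hq, (hf.indist_iff hP hS hq hq).2 fun _ _ _ _ _ => rfl⟩⟩
  subset := by
    classical
    rintro ⟨C, hC⟩
    obtain ⟨q, hq, rfl⟩ := Finset.mem_image.1 hC
    exact Finset.filter_subset _ _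
  indist C q hq q' hq' := ((hf.mem_classes_iff hP hS C.2 hq).1 hq').2
  not_indist C C' hne q hq q' hq' h := by
    have hS' : q' ∈ S := ((hf.mem_classes_iff hP hS C'.2 hq').1 hq').1
    exact hne (Subtype.ext (hf.classes_eq_of_mem hP hS C.2 C'.2
      ((hf.mem_classes_iff hP hS C.2 hq).2 ⟨hS', h⟩) hq'))

variable {b : Q → ℝ} [Fintype {C // C ∈ P.classes f (supp b)}]

theorem IsSEC.sum_restrict_classes (hf : P.IsSEC f) (hP : P.PosteriorDeterministic)
    (hb : ∀ q, 0 ≤ b q) (hS : supp b ∈ dom f) : ∑ C : {C // C ∈ P.classes f (supp b)}, restrict b C.1 = b := by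
  classical
  ext q
  rw [Finset.sum_apply]
  by_cases hq : q ∈ supp b
  · obtain ⟨C, hC, hqC⟩ := hf.exists_mem_classes hP hS hq
    rw [Finset.sum_eq_single (⟨C, hC⟩ : {C // C ∈ P.classes f (supp b)})]
    · simp [restrict, hqC]
    · intro C' _ hne
      refine if_neg fun hqC' => hne (Subtype.ext ?_)
      exact hf.classes_eq_of_mem hP hS C'.2 hC hqC' hqC
    · simp
  · have hz : b q = 0 := (hb q).antisymm' (not_lt.1 (mt mem_supp.2 hq))
    simp [restrict, hz]

/-- One inequality says that the class can be learned at no cost, the other is subadditivity of the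
value. -/
theorem IsSEC.sum_val_restrict_classes (hf : P.IsSEC f) (hP : P.PosteriorDeterministic) {top : Q}
    (htop : P.Absorbing top) (hb : IsSubBelief b) (hS : supp b ∈ dom f) :
    ∑ C : {C // C ∈ P.classes f (supp b)}, P.val {top} (restrict b C.1) = P.val {top} b := by
  have h1 := sum_val_transport_le hf hP htop hS (hf.areClasses hP hS) hb
  have e : ∀ C : Finset Q, transport C b id = restrict b C := fun C => transport_id C b fun _ _ => rfl
  simp only [e] at h1
  rw [hf.sum_restrict_classes hP hb.1 hS] at h1
  refine le_antisymm h1 ?_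
  have h2 := P.val_sum_le {top} Finset.univ (b := fun C : {C // C ∈ P.classes f (supp b)} =>
    restrict b C.1) fun C _ q => by
      unfold restrict
      split_ifs
      exacts [hb.1 q, le_rfl]
  rwa [hf.sum_restrict_classes hP hb.1 hS] at h2

end classes

end POMDP

/-! ### Propagation of the estimates through each kind of node -/

namespace UnfTree

variable {Q A O : Type u} [Fintype Q] [Fintype A] [Fintype O] {P : POMDP Q A O}

open POMDP

/-- The estimates at the root of `t`, together with the bounds that make the maxima finite. -/
structure IsEstimate (P : POMDP Q A O) (top : Q) (η : ℝ) (t : UnfTree Q A) : Prop where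
  isSubBelief : IsSubBelief t.label.toBelief
  extRank_nonneg : 0 ≤ t.extRank P
  extRank_le : t.extRank P ≤ Fintype.card (Finset Q)
  extVal_nonneg : 0 ≤ t.extVal top
  extVal_le : t.extVal top ≤ P.valLabel {top} t.label
  le_extVal : P.valLabel {top} t.label ≤
    t.extVal top + t.extRank P + (supp t.label.toBelief).card * η

theorem valLabel_le_val [Nonempty A] {top : Q} (htop : P.Absorbing top) {x : NodeLabel Q A}
    (hx : ∀ q, 0 ≤ x.toBelief q) : P.valLabel {top} x ≤ P.val {top} x.toBelief := by
  cases x with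
  | belief b => exact le_rfl
  | beliefAct b a => exact P.valAct_le_val htop hx a

theorem IsEstimate.extVal_le_one [Nonempty A] {top : Q} (htop : P.Absorbing top) {η : ℝ}
    {t : UnfTree Q A} (h : IsEstimate P top η t) : t.extVal top ≤ 1 :=
  h.extVal_le.trans ((valLabel_le_val htop h.isSubBelief.1).trans
    ((P.val_le_mass _ h.isSubBelief.1).trans h.isSubBelief.2))

/-- The truncation may also turn a pair `(b, a)` into a leaf, so both kinds of label have to be
treated. -/
theorem isEstimate_leaf [Nonempty A] (hP : P.PosteriorDeterministic) {top bot : Q}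
    (htop : P.Absorbing top) (hbot : ∀ q, P.val {top} (dirac q) = 0 ↔ q = bot) {η : ℝ}
    (hη : 0 ≤ η) {x : NodeLabel Q A} (hx : IsSubBelief x.toBelief) :
    IsEstimate P top η (.leaf x) where
  isSubBelief := hx
  extRank_nonneg := rank_nonneg hx.1
  extRank_le := rank_le hP hx
  extVal_nonneg := by
    rw [extVal]
    split_ifs
    exacts [mass_nonneg hx.1, le_rfl]
  extVal_le := by
    rw [extVal]
    have hval : 0 ≤ P.valLabel {top} x := by
      cases x with
      | belief b => exact P.val_nonneg _ hx.1
      | beliefAct b a =>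
        exact Finset.sum_nonneg fun o _ => mul_nonneg (P.obsProb_nonneg hx.1 a o)
          (P.val_nonneg _ (P.update_nonneg hx.1 a o))
    split_ifs with h
    · cases x with
      | belief b => exact (val_of_eq_zero_of_ne_top hx.1 fun _ => eq_zero_of_supp_eq hx.1 h).ge
      | beliefAct b a =>
        -- Absorption keeps all the mass on `top` after the action.
        have h1 : ∀ o, P.val {top} (P.push b a o) = P.obsProb b a o := by
          intro o
          rw [← mass_push]
          refine val_of_eq_zero_of_ne_top (P.push_nonneg hx.1 a o) fun q hq => ?_
          refine Finset.sum_eq_zero fun r _ => ?_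
          by_cases hr : r = top
          · rw [hr, ((P.T_nonneg top a o q).eq_or_lt.resolve_right
              fun hlt => hq (htop _ _ _ hlt)).symm, mul_zero]
          · have h2 : b r = 0 := eq_zero_of_supp_eq hx.1 h hr
            rw [h2, zero_mul]
        exact ((P.valAct_eq _ hx.1 a).trans
          ((Finset.sum_congr rfl fun o _ => h1 o).trans (P.sum_obsProb b a))).ge
    · exact hval
  le_extVal := by
    refine (valLabel_le_val htop hx.1).trans ((val_le_leaf hP htop hbot hx.1).trans ?_)
    exact le_add_of_nonneg_right (mul_nonneg (Nat.cast_nonneg _) hη)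

/-- The children have supports of no greater size, so the `η`-term of the parent dominates theirs,
and a combination with weights of total at most `1` preserves this bound. -/
theorem isEstimate_sum {top : Q} {η : ℝ} (hη : 0 ≤ η) {x : NodeLabel Q A}
    (hx : IsSubBelief x.toBelief) {ι : Type u} [Fintype ι] {w : ι → ℝ} {child : ι → UnfTree Q A}
    (hchild : ∀ i, IsEstimate P top η (child i)) (hw : ∀ i, 0 ≤ w i) (hw1 : ∑ i, w i ≤ 1)
    (hval : P.valLabel {top} x = ∑ i, w i * P.valLabel {top} (child i).label)
    (hcard : ∀ i, (supp (child i).label.toBelief).card ≤ (supp x.toBelief).card) :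
    IsEstimate P top η (.sum x ι w child) where
  isSubBelief := hx
  extRank_nonneg := Finset.sum_nonneg fun i _ => mul_nonneg (hw i) (hchild i).extRank_nonneg
  extRank_le := by
    refine (Finset.sum_le_sum fun i _ =>
      mul_le_mul_of_nonneg_left (hchild i).extRank_le (hw i)).trans ?_
    rw [← Finset.sum_mul]
    exact mul_le_of_le_one_left (Nat.cast_nonneg _) hw1
  extVal_nonneg := Finset.sum_nonneg fun i _ => mul_nonneg (hw i) (hchild i).extVal_nonneg
  extVal_le := hval ▸ Finset.sum_le_sum fun i _ =>
    mul_le_mul_of_nonneg_left (hchild i).extVal_le (hw i)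
  le_extVal := by
    change P.valLabel {top} x ≤ ∑ i, w i * (child i).extVal top + ∑ i, w i * (child i).extRank P +
      (supp x.toBelief).card * η
    rw [hval]
    set K : ℝ := (supp x.toBelief).card * η
    have hK : 0 ≤ K := mul_nonneg (Nat.cast_nonneg _) hη
    have h1 : ∀ i, w i * P.valLabel {top} (child i).label ≤
        w i * (child i).extVal top + w i * (child i).extRank P + w i * K := by
      intro i
      rw [← mul_add, ← mul_add]
      refine mul_le_mul_of_nonneg_left ((hchild i).le_extVal.trans (add_le_add le_rfl ?_)) (hw i)
      exact mul_le_mul_of_nonneg_right (Nat.cast_le.2 (hcard i)) hη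
    refine (Finset.sum_le_sum fun i _ => h1 i).trans ?_
    rw [Finset.sum_add_distrib, Finset.sum_add_distrib, ← Finset.sum_mul]
    exact add_le_add le_rfl (mul_le_of_le_one_left hK hw1)

/-- A real supremum is `0` on an empty or unbounded family. The uniform bounds in `IsEstimate`
exclude the unbounded case, and the nonnegativity of `B` in `hge` makes the empty case correct. -/
theorem isEstimate_max [Nonempty A] {top : Q} (htop : P.Absorbing top) {η : ℝ} (hη : 0 ≤ η)
    {b : Q → ℝ} (hb : IsSubBelief b) {ι : Type u} {child : ι → UnfTree Q A}
    (hchild : ∀ i, IsEstimate P top η (child i))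
    (hle : ∀ i, P.valLabel {top} (child i).label ≤ P.val {top} b)
    (hge : ∀ B, 0 ≤ B → (∀ i, P.valLabel {top} (child i).label ≤ B) → P.val {top} b ≤ B)
    (hcard : ∀ i, (supp (child i).label.toBelief).card ≤ (supp b).card) :
    IsEstimate P top η (.max (.belief b) ι child) where
  isSubBelief := hb
  extRank_nonneg := Real.iSup_nonneg fun i => (hchild i).extRank_nonneg
  extRank_le := Real.iSup_le (fun i => (hchild i).extRank_le) (Nat.cast_nonneg _)
  extVal_nonneg := Real.iSup_nonneg fun i => (hchild i).extVal_nonneg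
  extVal_le := Real.iSup_le (fun i => (hchild i).extVal_le.trans (hle i)) (P.val_nonneg _ hb.1)
  le_extVal := by
    have h1 : BddAbove (Set.range fun i => (child i).extVal top) :=
      ⟨1, by rintro _ ⟨i, rfl⟩; exact (hchild i).extVal_le_one htop⟩
    have h2 : BddAbove (Set.range fun i => (child i).extRank P) :=
      ⟨_, by rintro _ ⟨i, rfl⟩; exact (hchild i).extRank_le⟩
    refine hge _ (add_nonneg (add_nonneg (Real.iSup_nonneg fun i => (hchild i).extVal_nonneg)
      (Real.iSup_nonneg fun i => (hchild i).extRank_nonneg))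
      (mul_nonneg (Nat.cast_nonneg _) hη)) fun i => (hchild i).le_extVal.trans ?_
    exact add_le_add (add_le_add (le_ciSup h1 i) (le_ciSup h2 i))
      (mul_le_mul_of_nonneg_right (Nat.cast_le.2 (hcard i)) hη)

theorem cutBelief_nonneg {η : ℝ} {b : Q → ℝ} (hb : ∀ q, 0 ≤ b q) (q : Q) :
    0 ≤ cutBelief η b q := by
  unfold cutBelief
  split_ifs
  exacts [le_rfl, hb q]

theorem cutBelief_le {η : ℝ} {b : Q → ℝ} (hb : ∀ q, 0 ≤ b q) (q : Q) :
    cutBelief η b q ≤ b q := by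
  unfold cutBelief
  split_ifs
  exacts [hb q, le_rfl]

/-- The comparison is made state by state: a removed state loses mass less than `η` and frees
exactly one `η` of the support term. -/
theorem card_supp_cutBelief {η : ℝ} {b : Q → ℝ} (hb : ∀ q, 0 ≤ b q) :
    ((supp (cutBelief η b)).card : ℝ) * η + ∑ q, (b q - cutBelief η b q) ≤
      (supp b).card * η := by
  classical
  have h : ∀ c : Q → ℝ, ((supp c).card : ℝ) * η = ∑ q, if 0 < c q then η else 0 := by
    intro c
    rw [supp, Finset.card_filter, Nat.cast_sum, Finset.sum_mul]
    refine Finset.sum_congr rfl fun q _ => ?_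
    split_ifs <;> simp
  rw [h, h, ← Finset.sum_add_distrib]
  refine Finset.sum_le_sum fun q _ => ?_
  rcases (hb q).eq_or_lt with h0 | h0
  · simp [cutBelief, ← h0]
  · by_cases hlt : b q < η
    · simp [cutBelief, hlt, h0, hlt.le]
    · simp [cutBelief, hlt, h0]

theorem isEstimate_cut [Nonempty A] {top : Q} {η : ℝ}
    {b : Q → ℝ} (hb : IsSubBelief b) {child : UnfTree Q A} (hchild : IsEstimate P top η child)
    (hlabel : child.label = .belief (cutBelief η b)) :
    IsEstimate P top η (.cut (.belief b) child) where
  isSubBelief := hb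
  extRank_nonneg := hchild.extRank_nonneg
  extRank_le := hchild.extRank_le
  extVal_nonneg := hchild.extVal_nonneg
  extVal_le := by
    have h1 := hchild.extVal_le
    rw [hlabel] at h1
    exact h1.trans (P.val_mono _ (cutBelief_nonneg hb.1) (cutBelief_le hb.1))
  le_extVal := by
    have h1 := hchild.le_extVal
    rw [hlabel] at h1
    have h2 := P.val_le_val_add_mass {top} (cutBelief_nonneg (η := η) hb.1) (cutBelief_le hb.1)
    have h3 := card_supp_cutBelief (η := η) hb.1
    change P.val {top} b ≤ child.extVal top + child.extRank P + (supp b).card * η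
    change P.val {top} (cutBelief η b) ≤
      child.extVal top + child.extRank P + (supp (cutBelief η b)).card * η at h1
    linarith

/-! ### The nodes of the unfolding tree -/

theorem label_unfold (top bot : Q) (η : ℝ) (n : ℕ) (x : NodeLabel Q A) :
    (P.unfold top bot η n x).label = x := by
  cases n with
  | zero => rw [POMDP.unfold]; rfl
  | succ n =>
    cases x with
    | beliefAct b a => rw [POMDP.unfold]; rfl
    | belief b =>
      rw [POMDP.unfold]
      split_ifs <;> rfl

theorem node_leaf {x : NodeLabel Q A} {y : UnfTree Q A} (h : Node (.leaf x) y) : y = .leaf x := by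
  cases h
  rfl

theorem card_supp_update_le (hP : P.PosteriorDeterministic) {b : Q → ℝ} (hb : ∀ q, 0 ≤ b q)
    (a : A) (o : O) : (supp (P.update b a o)).card ≤ (supp b).card := by
  refine le_trans (Finset.card_le_card fun q hq => ?_) (hP.card_delta_le (supp b) a o)
  rw [mem_supp, P.update_eq] at hq
  have h1 : 0 < P.push b a o q :=
    pos_of_mul_pos_right hq (inv_nonneg.2 (P.obsProb_nonneg hb a o))
  obtain ⟨r, -, hr⟩ := Finset.exists_ne_zero_of_sum_ne_zero h1.ne'
  exact P.mem_delta.2 ⟨r, mem_supp.2 ((hb r).lt_of_ne' (left_ne_zero_of_mul hr)),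
    (P.T_nonneg _ _ _ _).lt_of_ne' (right_ne_zero_of_mul hr)⟩

theorem restrict_nonneg {b : Q → ℝ} (hb : ∀ q, 0 ≤ b q) (C : Finset Q) (q : Q) :
    0 ≤ restrict b C q := by
  unfold restrict
  split_ifs
  exacts [hb q, le_rfl]

theorem supp_restrict_subset (b : Q → ℝ) (C : Finset Q) : supp (restrict b C) ⊆ supp b := by
  intro q hq
  rw [mem_supp, restrict] at hq
  split_ifs at hq with h
  · exact mem_supp.2 hq
  · exact absurd hq (lt_irrefl _)

theorem sum_obsProb_subtype {b : Q → ℝ} (hb : ∀ q, 0 ≤ b q) (a : A)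
    [Fintype {o // 0 < P.obsProb b a o}] (v : O → ℝ) :
    ∑ o : {o // 0 < P.obsProb b a o}, P.obsProb b a o * v o = ∑ o, P.obsProb b a o * v o := by
  classical
  rw [← Finset.sum_subtype (Finset.univ.filter fun o => 0 < P.obsProb b a o) (by simp)
    fun o => P.obsProb b a o * v o]
  refine Finset.sum_filter_of_ne fun o _ ho => ?_
  exact (P.obsProb_nonneg hb a o).lt_of_ne' (left_ne_zero_of_mul ho)

/-- Every node of the unfolding tree satisfies the estimates. -/
theorem isEstimate_of_node [Nonempty A] (hP : P.PosteriorDeterministic) {top bot : Q}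
    (htop : P.Absorbing top) (htop' : P.Observable top)
    (hbot : ∀ q, P.val {top} (dirac q) = 0 ↔ q = bot) {η : ℝ} (hη : 0 ≤ η) (n : ℕ) :
    ∀ (x : NodeLabel Q A), IsSubBelief x.toBelief →
      ∀ y, (P.unfold top bot η n x).Node y → IsEstimate P top η y := by
  classical
  induction n with
  | zero =>
    intro x hx y hy
    rw [POMDP.unfold] at hy
    rw [node_leaf hy]
    exact isEstimate_leaf hP htop hbot hη hx
  | succ n ih =>
    have ihr : ∀ (x : NodeLabel Q A), IsSubBelief x.toBelief →
        IsEstimate P top η (P.unfold top bot η n x) := fun x hx => ih x hx _ (Node.root _)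
    intro x hx y hy
    cases x with
    | beliefAct b a =>
      change IsSubBelief b at hx
      have hsub : ∀ o, 0 < P.obsProb b a o → IsSubBelief (P.update b a o) :=
        fun o ho => ⟨P.update_nonneg hx.1 a o, (mass_update P ho).le⟩
      rw [POMDP.unfold] at hy
      cases hy with
      | root =>
        refine isEstimate_sum (x := .beliefAct b a) hη hx
          (fun o => ihr (.belief (P.update b a o.1)) (hsub o.1 o.2)) (fun o => o.2.le) ?_ ?_ ?_
        · have h1 := sum_obsProb_subtype (P := P) hx.1 a fun _ => 1
          simp only [mul_one] at h1
          rw [h1, P.sum_obsProb]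
          exact hx.2
        · simp only [label_unfold]
          exact (sum_obsProb_subtype hx.1 a fun o => P.val {top} (P.update b a o)).symm
        · intro o
          rw [label_unfold]
          exact card_supp_update_le hP hx.1 a o.1
      | sum _ _ _ _ o _ hy => exact ih (.belief _) (hsub o.1 o.2) _ hy
    | belief b =>
      change IsSubBelief b at hx
      rw [POMDP.unfold] at hy
      split_ifs at hy with h1 h2 h3 h4
      · rw [node_leaf hy]
        exact isEstimate_leaf hP htop hbot hη hx
      · have hsub : IsSubBelief (cutBelief η b) := ⟨cutBelief_nonneg hx.1,
          (Finset.sum_le_sum fun q _ => cutBelief_le hx.1 q).trans hx.2⟩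
        cases hy with
        | root => exact isEstimate_cut hx (ihr (.belief _) hsub) (label_unfold _ _ _ _ _)
        | cut _ _ _ hy => exact ih (.belief _) hsub _ hy
      · have hf : P.IsSEC h3.choose := h3.choose_spec.1.prop
        have hS : supp b ∈ dom h3.choose := h3.choose_spec.2
        have hm : 0 < mass b := mass_pos hx.1 (hf.nonempty_of_mem _ hS)
        have hC : ∀ C : {C // C ∈ P.classes h3.choose (supp b)}, 0 < mass (restrict b C.1) := by
          intro C
          obtain ⟨q, hq⟩ := (hf.areClasses hP hS).nonempty C
          refine mass_pos (restrict_nonneg hx.1 C.1) ⟨q, mem_supp.2 ?_⟩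
          rw [restrict, if_pos hq]
          exact mem_supp.1 ((hf.areClasses hP hS).subset C hq)
        have hsub : ∀ C : {C // C ∈ P.classes h3.choose (supp b)},
            IsSubBelief ((mass b / mass (restrict b C.1)) • restrict b C.1) := fun C =>
          ⟨smul_nonneg_apply (div_nonneg hm.le (hC C).le) (restrict_nonneg hx.1 C.1), by
            change mass _ ≤ 1
            rw [mass_smul, div_mul_cancel₀ _ (hC C).ne']
            exact hx.2⟩
        cases hy with
        | root =>
          refine isEstimate_sum (x := .belief b) hη hx (fun C => ihr (.belief _) (hsub C))
            (fun C => div_nonneg (hC C).le hm.le) ?_ ?_ ?_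
          · rw [← Finset.sum_div, ← mass_sum, hf.sum_restrict_classes hP hx.1 hS]
            exact (div_self hm.ne').le
          -- By homogeneity the edge weight and the rescaling of the child cancel, leaving the value
          -- of `restrict b C`.
          · simp only [label_unfold]
            refine (hf.sum_val_restrict_classes hP htop hx hS).symm.trans
              (Finset.sum_congr rfl fun C _ => ?_)
            change _ = _ * P.val {top} ((mass b / mass (restrict b C.1)) • restrict b C.1)
            rw [P.val_smul _ (div_nonneg hm.le (hC C).le) (restrict_nonneg hx.1 C.1), ← mul_assoc,
              div_mul_div_cancel₀ hm.ne', div_self (hC C).ne', one_mul]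
          · intro C
            rw [label_unfold]
            change (supp ((mass b / mass (restrict b C.1)) • restrict b C.1)).card ≤ _
            rw [supp_smul (div_pos hm (hC C))]
            exact Finset.card_le_card (supp_restrict_subset b C.1)
        | sum _ _ _ _ C _ hy => exact ih (.belief _) (hsub C) _ hy
      · have hf : P.InNondist h3.choose b :=
          ⟨h3.choose_spec.1.prop, h3.choose_spec.2, h4⟩
        have hspec := fun c hc => hf.reachBelief_spec (c := c) hP hx.1 hc
        have hsub : ∀ c, P.ReachBelief h3.choose b c → IsSubBelief c := fun c hc =>
          ⟨(hspec c hc).1, (hspec c hc).2.1.trans_le hx.2⟩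
        cases hy with
        | root =>
          refine isEstimate_max htop hη hx
            (fun p => ihr (.beliefAct p.1.1 p.1.2) (hsub _ p.2.1)) ?_ ?_ ?_
          · intro p
            rw [label_unfold, ← hf.val_reachBelief hP htop hx.1 p.2.1]
            exact P.valAct_le_val htop (hspec _ p.2.1).1 _
          · intro B hB h
            -- The leaf rule did not apply, so the support is not `{top}` and the component avoids
            -- `top`.
            refine hf.val_le hP htop htop' hx.1 (fun h => h1 (Or.inl h)) hB fun c a hc ha => ?_
            have h5 := h ⟨(c, a), hc, ha⟩
            rwa [label_unfold] at h5
          · intro p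
            rw [label_unfold]
            exact (hf.isSEC.card_eq hP (hspec _ p.2.1).2.2 hf.mem).le
        | max _ _ _ p _ hy => exact ih (.beliefAct _ _) (hsub _ p.2.1) _ hy
      · cases hy with
        | root =>
          refine isEstimate_max htop hη hx (fun a => ihr (.beliefAct b a) hx) ?_ ?_ ?_
          · intro a
            rw [label_unfold]
            exact P.valAct_le_val htop hx.1 a
          · intro B _ h
            simp only [label_unfold] at h
            exact P.val_le_of_valAct_le htop hx.1 h
          · intro a
            rw [label_unfold]
            exact le_rfl
        | max _ _ _ a _ hy => exact ih (.beliefAct b a) hx _ hy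

end UnfTree

theorem mainTheorem4 {Q A O : Type u} [Fintype Q] [Fintype A] [Fintype O] [Nonempty A]
    (P : POMDP Q A O) (hP : P.PosteriorDeterministic)
    (top bot : Q)
    (htop_abs : P.Absorbing top) (htop_obs : P.Observable top)
    (hbot_abs : P.Absorbing bot) (hbot_obs : P.Observable bot)
    (hbot : ∀ q, P.val {top} (POMDP.dirac q) = 0 ↔ q = bot)
    (η : ℝ) (hη : 0 < η)
    (b : Q → ℝ) (hb : POMDP.IsSubBelief b)
    (n : ℕ) (x : UnfTree Q A) (hx : (P.unfold top bot η n (.belief b)).Node x) :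
    (x.extVal top ≤ P.valLabel {top} x.label ∧
      P.valLabel {top} x.label ≤
        x.extVal top + x.extRank P + (POMDP.supp x.label.toBelief).card * η) ∧
    x.extVal top ≤ P.val {top} x.label.toBelief := by
  have h := UnfTree.isEstimate_of_node hP htop_abs htop_obs hbot hη.le n (.belief b) hb x hx
  exact ⟨⟨h.extVal_le, h.le_extVal⟩,
    h.extVal_le.trans (UnfTree.valLabel_le_val htop_abs h.isSubBelief.1)⟩
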